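/- Let $q$ be a power of an odd prime, and let $x_0,x_1,x_2,\dots$ be elements of an extension field of $\mathbb F_{q^2}$ such that $x_0$ is transcendental over $\mathbb F_{q^2}$ and $$x_{i+1}^{\,q-1}+(x_i+1)^{q-1}=1\qquad(i\ge 0).$$ A place of a function field $F/K$ is given by a valuation ring $\mathcal O$ with $K\subseteq\mathcal O\subsetneq F$; it is called $K$-rational if its residue field has degree one over $K$, and $f\equiv c$ at a place means that $f-c$ lies in the maximal ideal of its valuation ring. Let $1\le t\le m$ be integers with $q\equiv-1\pmod{2^t}$, and let $S$ be the set of places $Q$ of $\mathbb F_{q^2}(x_{m-t},x_{m-t+1},\dots,x_{m+t})$ such that - $Q$ is a zero of $x_m-\beta$ for some $\beta\in\mathbb F_q^*\setminus\{-1\}$, - $Q$ is $\mathbb F_{q^2}$-rational, and - $Q$ is not $\mathbb F_q$-rational, i.e. $Q$ does not lie over an $\mathbb F_q$-rational place of $\mathbb F_q(x_{m-t},\dots,x_{m+t})$. Then $S$ has exactly $2^{t-1}(q-1)$ elements. Moreover, put $\alpha_0=1$, and let $T$ be the set of tuples $(\alpha_1,\dots,\alpha_t)\in\mathbb F_{q^2}^{\,t}$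 such that $$\alpha_i^2=-\frac1{\alpha_{i-1}}\quad(1\le i<t),\qquad \alpha_t^{\,q-1}=-\alpha_{t-1}$$ (so $\alpha_1^2=-1$ if $t\ge2$, and the only condition is $\alpha_1^{q-1}=-1$ if $t=1$). Then there is a bijection $S\to T$ such that, if $Q\in S$ is sent to $(\alpha_1,\dots,\alpha_t)$, then at $Q$ $$x_m\equiv-\tfrac12,\qquad \frac{x_{m+i}}{x_{m-i}+1}\equiv\alpha_i\quad(1\le i\le t).$$ -/

import Mathlib

/-- A place of a function field `F / K`, given by its valuation ring: a valuation ring `O` of `F`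
with `K ⊆ O ⊊ F`. (The inclusion of `K` in `O` is then automatically strict.) -/
structure Place (K F : Type*) [Field K] [Field F] [Algebra K F] where
  ring : ValuationSubring F
  algebraMap_mem : ∀ c : K, algebraMap K F c ∈ ring
  ne_top : ring ≠ ⊤

namespace Place

variable {K F : Type*} [Field K] [Field F] [Algebra K F]

/-- The valuation ring of a place of `F / K` is a `K`-algebra. -/
instance (P : Place K F) : Algebra K P.ring :=
  ((algebraMap K F).codRestrict P.ring P.algebraMap_mem).toAlgebra

/-- The degree of a place: the dimension over `K` of its residue field. -/
noncomputable def degree (P : Place K F) : ℕ :=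
  Module.finrank K (IsLocalRing.ResidueField P.ring)

/-- A place of `F / K` is `K`-rational if it has degree one. -/
def IsRational (P : Place K F) : Prop := P.degree = 1

/-- `P` is a zero of `f`: the function `f` lies in the maximal ideal of the valuation ring. -/
def IsZero (P : Place K F) (f : F) : Prop := f ∈ P.ring.nonunits

/-- `f ≡ c` at the place `P`, for a constant `c` of `K`. -/
def Congr (P : Place K F) (f : F) (c : K) : Prop := P.IsZero (f - algebraMap K F c)

/-- The place `Q` of `F / K` lies over the place `P` of `F₀ / k`, where `φ` embeds `F₀` in `F`:
the valuation ring of `P` is the restriction to `F₀` of that of `Q`. -/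
def LiesOver {k F₀ : Type*} [Field k] [Field F₀] [Algebra k F₀]
    (Q : Place K F) (P : Place k F₀) (φ : F₀ →+* F) : Prop :=
  P.ring = Q.ring.comap φ

end Place

/-- The elements `x 0, x 1, x 2, …` of an extension field of `K` generate the tower
`x_{i+1}^{q-1} + (x_i + 1)^{q-1} = 1` over the rational function field `K(x_0)`. -/
structure IsKummerTower (q : ℕ) (K : Type*) {L : Type*} [Field K] [Field L] [Algebra K L]
    (x : ℕ → L) : Prop where
  transcendental : Transcendental K (x 0)
  equation : ∀ i, x (i + 1) ^ (q - 1) + (x i + 1) ^ (q - 1) = 1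

/-- Such towers exist over every field (for `q > 1`). -/
theorem exists_isKummerTower {q : ℕ} (hq : 1 < q) (K : Type*) [Field K] :
    ∃ x : ℕ → AlgebraicClosure (RatFunc K), IsKummerTower q K x := by
  have h : ∀ y : AlgebraicClosure (RatFunc K), ∃ z : AlgebraicClosure (RatFunc K),
      z ^ (q - 1) = 1 - (y + 1) ^ (q - 1) :=
    fun y => IsAlgClosed.exists_pow_nat_eq _ (by omega)
  choose f hf using h
  refine ⟨fun n => Nat.rec (algebraMap (RatFunc K) _ RatFunc.X) (fun _ y => f y) n, ?_, ?_⟩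
  · exact (transcendental_algebraMap_iff
      (algebraMap (RatFunc K) (AlgebraicClosure (RatFunc K))).injective).2
      RatFunc.transcendental_X
  · intro i
    simp [hf]

/-- The field `K(x_a, x_{a+1}, …, x_b)`. -/
abbrev windowField (K : Type*) {L : Type*} [Field K] [Field L] [Algebra K L]
    (x : ℕ → L) (a b : ℕ) : IntermediateField K L :=
  IntermediateField.adjoin K (x '' Set.Icc a b)

/-- The element `x_i` of `K(x_a, …, x_b)`, where `a ≤ i ≤ b`. -/
def windowGen (K : Type*) {L : Type*} [Field K] [Field L] [Algebra K L]
    (x : ℕ → L) (a b i : ℕ) (h : a ≤ i ∧ i ≤ b) : windowField K x a b :=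
  ⟨x i, IntermediateField.subset_adjoin K _ ⟨i, h, rfl⟩⟩

/-- The inclusion of `k(x_a, …, x_b)` in `K(x_a, …, x_b)`, where `K` extends `k`. -/
def windowInclusion (k K : Type*) {L : Type*} [Field k] [Field K] [Field L] [Algebra k K]
    [Algebra k L] [Algebra K L] [IsScalarTower k K L] (x : ℕ → L) (a b : ℕ) :
    windowField k x a b →+* windowField K x a b :=
  (IntermediateField.inclusion
    (show windowField k x a b ≤ (windowField K x a b).restrictScalars k from
      IntermediateField.adjoin_le_iff.2 (IntermediateField.subset_adjoin K _))).toRingHom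

/-- The places of `K(x_{m-t}, …, x_{m+t})` that are `K`-rational but not `k`-rational (they do not
lie over a rational place of `k(x_{m-t}, …, x_{m+t})`), and that are zeros of `x_m - β` for some
`β ∈ k` other than `0` and `-1`. -/
def centralPlaces (k K : Type*) {L : Type*} [Field k] [Field K] [Field L] [Algebra k K]
    [Algebra k L] [Algebra K L] [IsScalarTower k K L] (x : ℕ → L) (m t : ℕ) :
    Set (Place K (windowField K x (m - t) (m + t))) :=
  {Q | Q.IsRational ∧
    (¬ ∃ P : Place k (windowField k x (m - t) (m + t)),
      Q.LiesOver P (windowInclusion k K x (m - t) (m + t)) ∧ P.IsRational) ∧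
    ∃ β : k, β ≠ 0 ∧ β ≠ -1 ∧
      Q.IsZero (windowGen K x (m - t) (m + t) m (by omega) - algebraMap K _ (algebraMap k K β))}

/-- The entry `α_i` of a tuple `(α_1, …, α_t)`, with `α_0 = 1` (and the unused value `0` for
`i > t`). -/
def tupleEntry {K : Type*} [Field K] {t : ℕ} (α : Fin t → K) : ℕ → K
  | 0 => 1
  | i + 1 => if h : i < t then α ⟨i, h⟩ else 0

/-- The tuples `(α_1, …, α_t)` with `α_i ^ 2 = -1 / α_{i-1}` for `1 ≤ i < t` and
`α_t ^ (q-1) = -α_{t-1}`, where `α_0 = 1` (so that the first condition is `α_1 ^ 2 = -1`). -/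
def residueTuples (q : ℕ) (K : Type*) [Field K] (t : ℕ) : Set (Fin t → K) :=
  {α | (∀ i, 1 ≤ i → i < t → tupleEntry α i ^ 2 = -1 / tupleEntry α (i - 1)) ∧
    tupleEntry α t ^ (q - 1) = -tupleEntry α (t - 1)}

/-!
Write `n = q - 1`, `y_i = x_{m+i}` and `z_i = -(x_{m-i} + 1)`. Both sequences satisfy the same
equation `w_{i+1}^n (1 + w_i) = w_i - w_i^q` (`IsBranch`), and `z_0 = -(1 + y_0)` (`IsBranchPair`).
At a place with `x_m ≡ β`, `β ∈ k` other than `0` and `-1`, all `y_i` and `z_i` with `i ≥ 1` vanish,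
while the ratios `u_i = y_i / -z_i = x_{m+i} / (x_{m-i} + 1)` are units with
`u_1^n ≡ β / (1 + β)` and `u_{i+1}^n ≡ -u_i`.

*Values.* If the place is rational over `K`, the field with `q^2` elements, then `β / (1 + β)`
is an `n`-th power in `K`, so its square is `1` and `β = -1/2` (`eq_neg_half_of_pow_eq`). The
values `α_i` of the `u_i` then satisfy `α_{i+1}^n = -α_i` with `α_0 = 1`, and `q ≡ -1 mod 2^t` makes
this equivalent to the conditions on the tuples (`isResidueChain_tupleEntry_iff`), which are
counted one entry at a time (`ncard_residueTuples`). As `α_1^n = -1`, the value of `u_1` is not in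
`k`, so no such place lies over a `k`-rational one.

*Uniqueness and rationality.* Given the values `α_i`, consider the local ring of
`K[y_i, z_i, u_i]` at the corresponding point. The equations show that `y_t` divides each generator
minus its value (`IsBranchPair.mem_span`), so this Noetherian local ring has a principal maximal
ideal. Hence it is a valuation ring with residue field `K`, and every place with these values equals
it (`discrete_of_generators`).

*Existence.* By the same criterion a single branch over `x_b ≡ 1` is totally ramified, so that by
Eisenstein's criterion each step down the tower has full degree `n` (`IsKummerTower.irreducible`).
Starting from any valuation ring at which `x_m ≡ -1/2`, the values are corrected one at a time: the
next one is `ζ α_{s+1}` with `ζ ∈ k` nonzero, and the Kummer homomorphism that multiplies `z_{s+1}`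
by `ζ` removes `ζ` (`IsKummerTower.exists_isCentralAt_succ`).
-/

/-! ### Valuation rings with a principal maximal ideal -/

/-- If the elements of `S` are constant modulo `J`, which is closed under multiplication by `K[S]`,
then so are all elements of `K[S]`. -/
theorem exists_const_of_mem_adjoin {K F : Type*} [Field K] [Field F] [Algebra K F] {S : Set F}
    {J : AddSubgroup F} (hJ : ∀ r ∈ Algebra.adjoin K S, ∀ f ∈ J, r * f ∈ J)
    (h : ∀ s ∈ S, ∃ c : K, s - algebraMap K F c ∈ J) {b : F} (hb : b ∈ Algebra.adjoin K S) :
    ∃ c : K, b - algebraMap K F c ∈ J := by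
  induction hb using Algebra.adjoin_induction with
  | mem s hs => exact h s hs
  | algebraMap a => exact ⟨a, by simp⟩
  | add x y hx hy ihx ihy =>
    obtain ⟨a, ha⟩ := ihx
    obtain ⟨a', ha'⟩ := ihy
    refine ⟨a + a', ?_⟩
    rw [map_add, add_sub_add_comm]
    exact add_mem ha ha'
  | mul x y hx hy ihx ihy =>
    obtain ⟨a, ha⟩ := ihx
    obtain ⟨a', ha'⟩ := ihy
    refine ⟨a * a', ?_⟩
    have : x * y - algebraMap K F (a * a') = x * (y - algebraMap K F a') +
        algebraMap K F a' * (x - algebraMap K F a) := by rw [map_mul]; ring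
    rw [this]
    exact add_mem (hJ _ hx _ ha') (hJ _ (Subalgebra.algebraMap_mem _ _) _ ha)

theorem mul_mem_nonunits {F : Type*} [Field F] {O : ValuationSubring F} {a b : F} (ha : a ∈ O)
    (hb : b ∈ O.nonunits) : a * b ∈ O.nonunits :=
  O.coe_mem_nonunits_iff.2 (Ideal.mul_mem_left _ (⟨a, ha⟩ : O)
    ((O.coe_mem_nonunits_iff (a := ⟨b, O.nonunits_subset hb⟩)).1 hb))

theorem mem_of_pow_mem {F : Type*} [Field F] {O : ValuationSubring F} {a : F} {n : ℕ} (hn : n ≠ 0)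
    (h : a ^ n ∈ O) : a ∈ O := by
  rw [← O.valuation_le_one_iff, map_pow] at h
  rw [← O.valuation_le_one_iff]
  exact (pow_le_one_iff hn).1 h

theorem mem_nonunits_of_pow_mem {F : Type*} [Field F] {O : ValuationSubring F} {a : F} {n : ℕ}
    (hn : n ≠ 0) (h : a ^ n ∈ O.nonunits) : a ∈ O.nonunits := by
  rw [O.mem_nonunits_iff, map_pow] at h
  rw [O.mem_nonunits_iff]
  exact (pow_lt_one_iff hn).1 h

theorem pow_mem_nonunits {F : Type*} [Field F] {O : ValuationSubring F} {a : F} {n : ℕ}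
    (hn : n ≠ 0) (h : a ∈ O.nonunits) : a ^ n ∈ O.nonunits := by
  rw [O.mem_nonunits_iff] at h ⊢
  rw [map_pow]
  exact (pow_lt_one_iff hn).2 h

theorem mem_nonunits_of_mul_mem {F : Type*} [Field F] {O : ValuationSubring F} {a b : F}
    (ha : a ∉ O.nonunits) (h : a * b ∈ O.nonunits) : b ∈ O.nonunits := by
  rw [O.mem_nonunits_iff, not_lt] at ha
  rw [O.mem_nonunits_iff, map_mul] at h
  rw [O.mem_nonunits_iff]
  by_contra hb
  exact absurd h (not_lt.2 (one_le_mul ha (not_lt.1 hb)))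

theorem mem_of_sub_mem_nonunits {F : Type*} [Field F] {O : ValuationSubring F} {a b : F}
    (hb : b ∈ O) (h : a - b ∈ O.nonunits) : a ∈ O := by
  have := O.add_mem _ _ (O.nonunits_subset h) hb
  rwa [sub_add_cancel] at this

theorem inv_mem_of_notMem_nonunits {F : Type*} [Field F] {O : ValuationSubring F} {a : F}
    (ha : a ∉ O.nonunits) : a⁻¹ ∈ O := by
  rw [O.mem_nonunits_iff_or, not_or, not_not] at ha
  exact ha.2

/-- An element congruent to a unit is a unit. -/
theorem notMem_nonunits_of_sub_mem {F : Type*} [Field F] {O : ValuationSubring F} {a b : F}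
    (hb : b ∉ O.nonunits) (h : a - b ∈ O.nonunits) : a ∉ O.nonunits := by
  intro ha
  apply hb
  rw [← sub_sub_cancel a b]
  exact sub_mem ha h

theorem algebraMap_notMem_nonunits {K F : Type*} [Field K] [Field F] [Algebra K F]
    {O : ValuationSubring F} (hK : ∀ c : K, algebraMap K F c ∈ O) {c : K} (hc : c ≠ 0) :
    algebraMap K F c ∉ O.nonunits := by
  rw [O.mem_nonunits_iff_or, not_or, not_not, ← map_inv₀]
  exact ⟨by simpa using hc, hK _⟩

theorem adjoin_le_of_subset {K F : Type*} [Field K] [Field F] [Algebra K F]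
    {O : ValuationSubring F} {S : Set F} (hK : ∀ c : K, algebraMap K F c ∈ O) (hSO : S ⊆ O) :
    (Algebra.adjoin K S).toSubring ≤ O.toSubring := by
  intro b hb
  induction hb using Algebra.adjoin_induction with
  | mem s hs => exact hSO hs
  | algebraMap a => exact hK a
  | add x y _ _ hx hy => exact O.add_mem _ _ hx hy
  | mul x y _ _ hx hy => exact O.mul_mem _ _ hx hy

/-- Let `F` be the field of fractions of a finitely generated algebra `K[S]`, and let `O` be a
valuation ring of `F` that contains `K[S]`. If, up to constants, every generator is a multiple of
one `τ ∈ K[S]` in the local ring of `K[S]` at the centre of `O`, then that local ring is Noetherian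
with principal maximal ideal `(τ)`, hence a valuation ring, hence equal to `O`, which dominates it.
The hypothesis quantifies over all rings `R` between `K[S]` and `O` in which the units of `O` are
invertible, so that a divisibility can be checked without a description of the local ring. -/
theorem discrete_of_generators {K F : Type*} [Field K] [Field F] [Algebra K F]
    {O : ValuationSubring F} {S : Set F} (hS : S.Finite)
    (hfrac : ∀ f : F, ∃ r ∈ Algebra.adjoin K S, ∃ s ∈ Algebra.adjoin K S, f = r / s)
    (hK : ∀ c : K, algebraMap K F c ∈ O) (hSO : S ⊆ O) {τ : F} (hτO : τ ∈ O.nonunits)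
    (hτS : τ ∈ Algebra.adjoin K S)
    (h : ∀ s ∈ S, ∃ c : K, ∀ R : Subring F, (Algebra.adjoin K S).toSubring ≤ R →
      R ≤ O.toSubring → (∀ d ∈ R, d ∉ O.nonunits → d⁻¹ ∈ R) →
        s - algebraMap K F c ∈ Submodule.span R {τ}) :
    (∀ f ∈ O, ∃ b ∈ Algebra.adjoin K S, ∃ d ∈ Algebra.adjoin K S, d ∉ O.nonunits ∧ f = b / d) ∧
      ∀ f ∈ O.nonunits, ∃ g ∈ O, f = τ * g := by
  set B : Subring F := (Algebra.adjoin K S).toSubring with hB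
  have hBO : B ≤ O.toSubring := adjoin_le_of_subset hK hSO
  let P : Ideal B := (IsLocalRing.maximalIdeal O).comap (Subring.inclusion hBO : B →+* O.toSubring)
  have hP : P.IsPrime := Ideal.comap_isPrime _ _
  have memP : ∀ b : B, b ∈ P ↔ (b : F) ∈ O.nonunits := fun b =>
    (O.coe_mem_nonunits_iff (a := ⟨b, hBO b.2⟩)).symm
  let R := LocalSubring.ofPrime B P
  have hBR : B ≤ R.toSubring := LocalSubring.le_ofPrime B P
  have hRfrac : ∀ f ∈ R.toSubring, ∃ b ∈ B, ∃ d ∈ B, d ∉ O.nonunits ∧ f = b / d := by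
    intro f hf
    obtain ⟨⟨b, d⟩, e⟩ := IsLocalization.surj P.primeCompl (⟨f, hf⟩ : R.toSubring)
    have e' : f * d = b := congrArg Subtype.val e
    have hd : (d : B) ∉ P := d.2
    rw [memP] at hd
    refine ⟨b, b.2, d, d.1.2, hd, ?_⟩
    rw [eq_div_iff, e']
    intro h0
    exact hd (h0 ▸ zero_mem _)
  have hdiv : ∀ b ∈ B, ∀ d ∈ B, d ∉ O.nonunits → b / d ∈ R.toSubring := by
    intro b hb d hd hd'
    have hdu : IsUnit (algebraMap B R.toSubring ⟨d, hd⟩) :=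
      IsLocalization.map_units R.toSubring (⟨⟨d, hd⟩, fun h => hd' ((memP _).1 h)⟩ : P.primeCompl)
    obtain ⟨v, hv⟩ := hdu.exists_right_inv
    have hv' : d * v = 1 := congrArg Subtype.val hv
    have : b / d = b * v := by
      rw [div_eq_mul_inv, eq_comm, ← eq_inv_of_mul_eq_one_right hv']
    rw [this]
    exact mul_mem (hBR hb) v.2
  have hRO : R.toSubring ≤ O.toSubring := by
    intro f hf
    obtain ⟨b, hb, d, hd, hd', rfl⟩ := hRfrac f hf
    rw [div_eq_mul_inv]
    exact O.mul_mem _ _ (hBO hb) (inv_mem_of_notMem_nonunits hd')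
  have hRinv : ∀ d ∈ R.toSubring, d ∉ O.nonunits → d⁻¹ ∈ R.toSubring := by
    intro f hf hf'
    obtain ⟨b, hb, d, hd, hd', rfl⟩ := hRfrac f hf
    rw [inv_div]
    refine hdiv _ hd _ hb fun hb' => hf' ?_
    rw [div_eq_inv_mul]
    exact mul_mem_nonunits (inv_mem_of_notMem_nonunits hd') hb'
  have hτR : τ ∈ R.toSubring := hBR hτS
  have hmax : IsLocalRing.maximalIdeal R.toSubring ≤ Ideal.span {(⟨τ, hτR⟩ : R.toSubring)} := by
    rw [← IsLocalization.AtPrime.map_eq_maximalIdeal P, Ideal.map_le_iff_le_comap]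
    intro b hb
    rw [memP] at hb
    obtain ⟨a, ha⟩ := exists_const_of_mem_adjoin (K := K) (S := S)
      (J := (Submodule.span R.toSubring {τ}).toAddSubgroup)
      (fun r hr f hf => Submodule.smul_mem _ (⟨r, hBR hr⟩ : R.toSubring) hf)
      (fun s hs => (h s hs).imp fun c hc => hc R.toSubring hBR hRO hRinv) b.2
    obtain ⟨r, e⟩ := Submodule.mem_span_singleton.1 ha
    have ha : a = 0 := by
      by_contra ha
      refine algebraMap_notMem_nonunits hK ha ?_
      have : algebraMap K F a = b - r • τ := by rw [e]; ring
      rw [this]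
      exact sub_mem hb (mul_mem_nonunits (hRO r.2) hτO)
    rw [ha, map_zero, sub_zero] at e
    rw [Ideal.mem_comap, Ideal.mem_span_singleton']
    exact ⟨r, Subtype.ext e⟩
  have hBN : IsNoetherianRing B := by
    have : (Algebra.adjoin K S).FG := Subalgebra.fg_def.2 ⟨S, hS, rfl⟩
    have : Algebra.FiniteType K (Algebra.adjoin K S) := (Subalgebra.fg_iff_finiteType _).1 this
    exact (Algebra.FiniteType.isNoetherianRing K (Algebra.adjoin K S) : _)
  have hRN : IsNoetherianRing R.toSubring := IsLocalization.isNoetherianRing P.primeCompl _ hBN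
  have hmax' : IsLocalRing.maximalIdeal R.toSubring = Ideal.span {(⟨τ, hτR⟩ : R.toSubring)} := by
    refine le_antisymm hmax ?_
    rw [Ideal.span_singleton_le_iff_mem, IsLocalRing.mem_maximalIdeal]
    intro hu
    have hu' := hu.map (Subring.inclusion hRO : _ →+* O.toSubring)
    exact (O.coe_mem_nonunits_iff (a := ⟨τ, O.nonunits_subset hτO⟩)).1 hτO hu'
  have hval : ValuationRing R.toSubring :=
    ((tfae_of_isNoetherianRing_of_isLocalRing_of_isDomain R.toSubring).out 1 4).2
      (by rw [hmax']; exact ⟨⟨_, rfl⟩⟩)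
  have hRtot : ∀ f : F, f ∈ R.toSubring ∨ f⁻¹ ∈ R.toSubring := by
    intro f
    obtain ⟨a, ha, b, hb, rfl⟩ := hfrac f
    have key : ∀ a b : R.toSubring, a ∣ b → (b / a : F) ∈ R.toSubring := by
      rintro a _ ⟨g, rfl⟩
      by_cases ha : (a : F) = 0
      · simp [ha]
      · simp [ha]
    rcases ValuationRing.dvd_total (⟨a, hBR ha⟩ : R.toSubring)
      (⟨b, hBR hb⟩ : R.toSubring) with h | h
    · right
      rw [inv_div]
      exact key _ _ h
    · left
      exact key _ _ h
  -- A valuation ring is maximal for domination, so `O` is contained in `R`.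
  have hOR : O.toSubring ≤ R.toSubring := by
    intro f hf
    by_cases h0 : f ∈ O.nonunits
    · by_contra hfR
      have hinv := (hRtot f).resolve_left hfR
      rw [O.mem_nonunits_iff_or] at h0
      rcases h0 with rfl | h0
      · exact hfR (zero_mem _)
      · exact h0 (hRO hinv)
    · rcases hRtot f with h | h
      · exact h
      · rw [← inv_inv f]
        refine hRinv _ h fun h' => ?_
        rw [O.inv_mem_nonunits_iff] at h'
        exact h'.elim (fun h => h0 (h ▸ zero_mem _)) (fun h => h hf)
  refine ⟨fun f hf => hRfrac f (hOR hf), fun f hf => ?_⟩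
  have hf' : (⟨f, hOR (O.nonunits_subset hf)⟩ : R.toSubring) ∈
      IsLocalRing.maximalIdeal R.toSubring := by
    rw [IsLocalRing.mem_maximalIdeal]
    intro hu
    have hu' := hu.map (Subring.inclusion hRO : _ →+* O.toSubring)
    exact (O.coe_mem_nonunits_iff (a := ⟨f, O.nonunits_subset hf⟩)).1 hf hu'
  rw [hmax', Ideal.mem_span_singleton'] at hf'
  obtain ⟨g, hg⟩ := hf'
  exact ⟨g, hRO g.2, by rw [mul_comm]; exact (congrArg Subtype.val hg).symm⟩

/-- If the generators of `K[S]` have values in `K` and every element of `O` is a fraction of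
elements of `K[S]` with a unit denominator, then the residue field of `O` is `K`. -/
theorem exists_const_of_fractions {K F : Type*} [Field K] [Field F] [Algebra K F]
    {O : ValuationSubring F} {S : Set F} (hK : ∀ c : K, algebraMap K F c ∈ O) (hSO : S ⊆ O)
    (h : ∀ s ∈ S, ∃ c : K, s - algebraMap K F c ∈ O.nonunits)
    (hfrac : ∀ f ∈ O, ∃ b ∈ Algebra.adjoin K S, ∃ d ∈ Algebra.adjoin K S,
      d ∉ O.nonunits ∧ f = b / d) {f : F} (hf : f ∈ O) :
    ∃ c : K, f - algebraMap K F c ∈ O.nonunits := by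
  have hBO := adjoin_le_of_subset hK hSO
  have hJ : ∀ r ∈ Algebra.adjoin K S, ∀ f ∈ O.nonunits.toAddSubgroup,
      r * f ∈ O.nonunits.toAddSubgroup := fun r hr f hf => mul_mem_nonunits (hBO hr) hf
  obtain ⟨b, hb, d, hd, hd', rfl⟩ := hfrac f hf
  obtain ⟨a, ha⟩ := exists_const_of_mem_adjoin hJ h hb
  obtain ⟨a', ha'⟩ := exists_const_of_mem_adjoin hJ h hd
  have hd0 : d ≠ 0 := fun h => hd' (h ▸ zero_mem _)
  have ha0 : algebraMap K F a' ≠ 0 := by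
    intro h0
    rw [h0, sub_zero] at ha'
    exact hd' ha'
  refine ⟨a / a', ?_⟩
  have e : b / d - algebraMap K F (a / a') = d⁻¹ * ((b - algebraMap K F a) +
      algebraMap K F (-(a / a')) * (d - algebraMap K F a')) := by
    rw [map_neg, map_div₀]
    field_simp
    ring
  rw [e]
  exact mul_mem_nonunits (inv_mem_of_notMem_nonunits hd') (add_mem ha (mul_mem_nonunits (hK _) ha'))

/-- A valuation ring whose elements are fractions of elements of `K[S]` with unit denominators is
determined by the values of the generators. -/
theorem le_of_fractions {K F : Type*} [Field K] [Field F] [Algebra K F]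
    {O O' : ValuationSubring F} {S : Set F} (hK : ∀ c : K, algebraMap K F c ∈ O)
    (hK' : ∀ c : K, algebraMap K F c ∈ O') (hSO : S ⊆ O) (hSO' : S ⊆ O')
    (h : ∀ s ∈ S, ∃ c : K, s - algebraMap K F c ∈ O.nonunits ∧ s - algebraMap K F c ∈ O'.nonunits)
    (hfrac : ∀ f ∈ O, ∃ b ∈ Algebra.adjoin K S, ∃ d ∈ Algebra.adjoin K S,
      d ∉ O.nonunits ∧ f = b / d) : O ≤ O' := by
  have hBO := adjoin_le_of_subset hK hSO
  have hBO' := adjoin_le_of_subset hK' hSO'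
  intro f hf
  obtain ⟨b, hb, d, hd, hd', rfl⟩ := hfrac f hf
  obtain ⟨a, ha, ha'⟩ := exists_const_of_mem_adjoin (K := K) (S := S)
    (J := O.nonunits.toAddSubgroup ⊓ O'.nonunits.toAddSubgroup)
    (fun r hr f hf => ⟨mul_mem_nonunits (hBO hr) hf.1, mul_mem_nonunits (hBO' hr) hf.2⟩) h hd
  have ha0 : a ≠ 0 := by
    rintro rfl
    rw [map_zero, sub_zero] at ha
    exact hd' ha
  rw [div_eq_mul_inv]
  exact O'.mul_mem _ _ (hBO' hb) (inv_mem_of_notMem_nonunits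
    (notMem_nonunits_of_sub_mem (algebraMap_notMem_nonunits hK' ha0) ha'))

/-- Eisenstein's criterion for `X ^ n - c`, where `c` is a uniformizer of a valuation ring with
principal maximal ideal. -/
theorem irreducible_X_pow_sub_C_of_uniformizer {F : Type*} [Field F] {O : ValuationSubring F}
    {τ c : F} (hτ : τ ∈ O.nonunits) (h : ∀ f ∈ O.nonunits, ∃ g ∈ O, f = τ * g)
    (hc : c ∈ O.nonunits) (hc' : ∀ g ∈ O.nonunits, c ≠ τ * g) {n : ℕ} (hn : n ≠ 0) :
    Irreducible (Polynomial.X ^ n - Polynomial.C c : Polynomial F) := by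
  let c' : O := ⟨c, O.nonunits_subset hc⟩
  have hp : (Polynomial.X ^ n - Polynomial.C c' : Polynomial O).Monic :=
    Polynomial.monic_X_pow_sub_C _ hn
  have hirr : Irreducible (Polynomial.X ^ n - Polynomial.C c' : Polynomial O) := by
    refine Polynomial.IsEisensteinAt.irreducible (𝓟 := IsLocalRing.maximalIdeal O)
      ⟨?_, ?_, ?_⟩ inferInstance hp.isPrimitive ?_
    · rw [hp.leadingCoeff]
      exact fun h => (Ideal.ne_top_iff_one _).1 (IsLocalRing.maximalIdeal.isMaximal O).ne_top h
    · intro i hi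
      rw [Polynomial.natDegree_X_pow_sub_C] at hi
      rw [Polynomial.coeff_sub, Polynomial.coeff_X_pow, if_neg hi.ne, Polynomial.coeff_C, zero_sub]
      split_ifs
      · exact neg_mem (O.coe_mem_nonunits_iff.1 hc)
      · simp
    · rw [Polynomial.coeff_sub, Polynomial.coeff_X_pow, if_neg hn.symm, Polynomial.coeff_C_zero,
        zero_sub, neg_mem_iff]
      have hm : IsLocalRing.maximalIdeal O = Ideal.span {(⟨τ, O.nonunits_subset hτ⟩ : O)} := by
        refine le_antisymm (fun f hf => ?_) ?_
        · obtain ⟨g, hg, e⟩ := h f (O.coe_mem_nonunits_iff.2 hf)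
          exact Ideal.mem_span_singleton'.2 ⟨⟨g, hg⟩, Subtype.ext (by rw [e, mul_comm]; rfl)⟩
        · rw [Ideal.span_singleton_le_iff_mem]
          exact O.coe_mem_nonunits_iff.1 hτ
      rw [hm, Ideal.span_singleton_pow, Ideal.mem_span_singleton']
      rintro ⟨g, hg⟩
      refine hc' (g * τ) (mul_mem_nonunits g.2 hτ) ?_
      rw [show c = (c' : F) from rfl, ← hg]
      push_cast
      ring
    · rw [Polynomial.natDegree_X_pow_sub_C]
      exact Nat.pos_of_ne_zero hn
  rw [hp.irreducible_iff_irreducible_map_fraction_map (K := F)] at hirr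
  simpa [c'] using hirr

/-! ### The `q`-th power map -/

section Frobenius

theorem sub_pow_card {k R : Type*} [Field k] [Finite k] [CommRing R] [Algebra k R] (a b : R) :
    (a - b) ^ Nat.card k = a ^ Nat.card k - b ^ Nat.card k := by
  cases nonempty_fintype k
  rw [Nat.card_eq_fintype_card]
  exact map_sub (FiniteField.frobeniusAlgHom k R) a b

theorem algebraMap_pow_card {k R : Type*} [Field k] [Finite k] [CommRing R] [Algebra k R] (c : k) :
    algebraMap k R c ^ Nat.card k = algebraMap k R c := by
  cases nonempty_fintype k
  rw [Nat.card_eq_fintype_card, ← map_pow, FiniteField.pow_card]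

theorem pow_card_sub_self_eq_prod {k R : Type*} [Field k] [Fintype k] [CommRing R] [Algebra k R]
    (r : R) : r ^ Fintype.card k - r = ∏ c : k, (r - algebraMap k R c) := by
  have h1 := FiniteField.X_pow_card_sub_X_natDegree_eq k (Fintype.one_lt_card (α := k))
  have h := Polynomial.prod_multiset_X_sub_C_of_monic_of_roots_card_eq
    (p := (Polynomial.X ^ Fintype.card k - Polynomial.X : Polynomial k))
    (Polynomial.monic_X_pow_sub (by
      rw [Polynomial.degree_X]; exact_mod_cast Fintype.one_lt_card (α := k)))
    (by rw [FiniteField.roots_X_pow_card_sub_X, h1]; rfl)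
  rw [FiniteField.roots_X_pow_card_sub_X] at h
  have h2 := congrArg (Polynomial.aeval r) h
  rw [map_multiset_prod, Multiset.map_map] at h2
  simpa using h2.symm

theorem exists_eq_algebraMap_of_pow_card_eq {k R : Type*} [Field k] [Finite k] [CommRing R]
    [IsDomain R] [Algebra k R] {r : R} (h : r ^ Nat.card k = r) :
    ∃ c : k, r = algebraMap k R c := by
  cases nonempty_fintype k
  have h1 := pow_card_sub_self_eq_prod (k := k) r
  rw [Nat.card_eq_fintype_card] at h
  rw [h, sub_self, eq_comm, Finset.prod_eq_zero_iff] at h1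
  obtain ⟨c, -, hc⟩ := h1
  exact ⟨c, sub_eq_zero.1 hc⟩

/-- A root of `X ^ q - X` in the residue field is the value of an element of `k`. -/
theorem exists_congr_of_pow_card_congr {k F : Type*} [Field k] [Finite k] [Field F] [Algebra k F]
    {O : ValuationSubring F} (r : F) (h : r ^ Nat.card k - r ∈ O.nonunits) :
    ∃ c : k, r - algebraMap k F c ∈ O.nonunits := by
  cases nonempty_fintype k
  rw [Nat.card_eq_fintype_card, pow_card_sub_self_eq_prod] at h
  by_contra! hc
  rw [O.mem_nonunits_iff, map_prod] at h
  refine absurd h (not_lt.2 (Finset.one_le_prod' fun c _ => ?_))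
  have := hc c
  rwa [O.mem_nonunits_iff, not_lt] at this

end Frobenius

/-! ### Branches -/

/-- A branch of length `N`: a sequence satisfying the equation
`w_{i+1}^{q-1} = (w_i - w_i^q) / (1 + w_i)` for `i < N`. -/
def IsBranch {F : Type*} [Field F] (q N : ℕ) (w : ℕ → F) : Prop :=
  ∀ i < N, w (i + 1) ^ (q - 1) * (1 + w i) = w i - w i ^ q

/-- The local coordinates `w_0 - b, w_1, w_2, …` of a branch `w` at a point where `w_0` has the
value `b` and every later term vanishes. -/
def centered {F : Type*} [Field F] (b : F) (w : ℕ → F) : ℕ → F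
  | 0 => w 0 - b
  | i + 1 => w (i + 1)

section Branch

variable {k F : Type*} [Field k] [Field F] [Algebra k F] {w : ℕ → F} {N : ℕ}
  {O : ValuationSubring F} {β : k}

/-- Since `β ∈ k` is fixed by the `q`-th power map, centering does not change `w_i - w_i ^ q`. -/
theorem centered_sub_pow [Finite k] (β : k) (w : ℕ → F) (i : ℕ) :
    centered (algebraMap k F β) w i - centered (algebraMap k F β) w i ^ Nat.card k =
      w i - w i ^ Nat.card k := by
  cases i with
  | zero => simp only [centered, sub_pow_card, algebraMap_pow_card]; ring
  | succ i => rfl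

theorem one_sub_pow_notMem_nonunits {a : F} {n : ℕ} (hn : n ≠ 0) (ha : a ∈ O.nonunits) :
    1 - a ^ n ∉ O.nonunits := by
  refine notMem_nonunits_of_sub_mem (b := 1) (fun h => ?_) ?_
  · rw [O.mem_nonunits_iff, map_one] at h
    exact lt_irrefl _ h
  · rw [sub_sub_cancel_left]
    exact neg_mem (pow_mem_nonunits hn ha)

theorem one_add_notMem_nonunits {a : F} (ha : a ∈ O.nonunits) : 1 + a ∉ O.nonunits := by
  have := one_sub_pow_notMem_nonunits one_ne_zero (neg_mem ha)
  rwa [pow_one, sub_neg_eq_add] at this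

theorem one_add_notMem_nonunits_of_centered (hk : ∀ c : k, algebraMap k F c ∈ O) (hβ : β ≠ -1)
    {i : ℕ} (hc : centered (algebraMap k F β) w i ∈ O.nonunits) : 1 + w i ∉ O.nonunits := by
  cases i with
  | zero =>
    refine notMem_nonunits_of_sub_mem (b := algebraMap k F (1 + β))
      (algebraMap_notMem_nonunits hk fun h => hβ ?_) ?_
    · linear_combination h
    · rw [map_add, map_one, add_sub_add_left_eq_sub]
      exact hc
  | succ i => exact one_add_notMem_nonunits hc

/-- If `w_0` takes a value `β ∈ k`, `β ≠ -1`, then all later terms of the branch vanish. -/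
theorem IsBranch.centered_mem_nonunits [Finite k] (hk : ∀ c : k, algebraMap k F c ∈ O)
    (hw : IsBranch (Nat.card k) N w) (hβ : β ≠ -1) (h0 : w 0 - algebraMap k F β ∈ O.nonunits) :
    ∀ i ≤ N, centered (algebraMap k F β) w i ∈ O.nonunits := by
  have hq : 1 < Nat.card k := Finite.one_lt_card
  intro i hi
  induction i with
  | zero => exact h0
  | succ i ih =>
    have hc := ih (by omega)
    have h2 := hw i (by omega)
    rw [← centered_sub_pow β, mul_comm] at h2
    refine mem_nonunits_of_pow_mem (n := Nat.card k - 1) (by omega)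
      (mem_nonunits_of_mul_mem (one_add_notMem_nonunits_of_centered hk hβ hc) ?_)
    change (1 + w i) * w (i + 1) ^ (Nat.card k - 1) ∈ O.nonunits
    rw [h2]
    exact sub_mem hc (pow_mem_nonunits (by omega) hc)

theorem IsBranch.one_add_notMem_nonunits [Finite k] (hw : IsBranch (Nat.card k) N w)
    (hk : ∀ c : k, algebraMap k F c ∈ O) (hβ : β ≠ -1)
    (h0 : w 0 - algebraMap k F β ∈ O.nonunits) (i : ℕ) (hi : i ≤ N) : 1 + w i ∉ O.nonunits :=
  one_add_notMem_nonunits_of_centered hk hβ (hw.centered_mem_nonunits hk hβ h0 i hi)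

variable {R : Subring F}

/-- Each local coordinate is a multiple of the next one, because
`w_{i+1} ^ (q - 1) * (1 + w_i) = s (1 - s ^ (q - 1))` for the coordinate `s` of index `i`; hence
all of them are multiples of the last one. -/
theorem IsBranch.centered_mem_span [Finite k] (hinv : ∀ d ∈ R, d ∉ O.nonunits → d⁻¹ ∈ R)
    (hw : IsBranch (Nat.card k) N w)
    (hwR : ∀ i ≤ N, w i ∈ R) (hβR : algebraMap k F β ∈ R)
    (hc : ∀ i ≤ N, centered (algebraMap k F β) w i ∈ O.nonunits) :
    ∀ i ≤ N, centered (algebraMap k F β) w i ∈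
      Submodule.span R {centered (algebraMap k F β) w N} := by
  have hq : 1 < Nat.card k := Finite.one_lt_card
  have hcR : ∀ i ≤ N, centered (algebraMap k F β) w i ∈ R := by
    intro i hi
    cases i with
    | zero => exact sub_mem (hwR 0 hi) hβR
    | succ i => exact hwR _ hi
  intro i hi
  induction hi using Nat.decreasingInduction with
  | self => exact Submodule.mem_span_singleton_self _
  | of_succ i hi ih =>
    set J := Submodule.span R {centered (algebraMap k F β) w N}
    set s := centered (algebraMap k F β) w i with hs
    have hsO := hc i hi.le
    have hsR := hcR i hi.le
    have h2 := hw i hi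
    rw [← centered_sub_pow β, ← hs] at h2
    have hu := one_sub_pow_notMem_nonunits (n := Nat.card k - 1) (by omega) hsO
    have hu0 : 1 - s ^ (Nat.card k - 1) ≠ 0 := fun h => hu (h ▸ zero_mem _)
    have huR := hinv _ (sub_mem (one_mem _) (pow_mem hsR (Nat.card k - 1))) hu
    have hsq : s - s ^ Nat.card k = s * (1 - s ^ (Nat.card k - 1)) := by
      rw [mul_sub, mul_one, mul_pow_sub_one (by omega)]
    have hws : w (i + 1) ^ (Nat.card k - 1) = w (i + 1) ^ (Nat.card k - 2) * w (i + 1) := by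
      rw [← pow_succ]; congr 1; omega
    have e : s = (1 - s ^ (Nat.card k - 1))⁻¹ * (1 + w i) * w (i + 1) ^ (Nat.card k - 2) *
        w (i + 1) := by
      rw [hsq, hws] at h2
      field_simp
      linear_combination -h2
    rw [e]
    exact J.smul_mem ⟨_, mul_mem (mul_mem huR (add_mem (one_mem _) (hwR i hi.le)))
      (pow_mem (hwR _ hi) _)⟩ ih

/-- A form of Hensel's lemma for `X ^ (q - 1) - a ^ (q - 1)`: the cofactor of `u - a` in
`u (u ^ (q - 1) - a ^ (q - 1)) = (u - a) ((u - a) ^ (q - 1) - a ^ (q - 1))` is a unit if `u ≡ a`. -/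
theorem sub_mem_of_pow_sub_pow_mem [Finite k] {J : Submodule R F} {u a : F}
    (hinv : ∀ d ∈ R, d ∉ O.nonunits → d⁻¹ ∈ R) (hu : u ∈ R) (ha : a ∈ R)
    (ha' : a ∉ O.nonunits) (hua : u - a ∈ O.nonunits)
    (h : u ^ (Nat.card k - 1) - a ^ (Nat.card k - 1) ∈ J) : u - a ∈ J := by
  have hq : 1 < Nat.card k := Finite.one_lt_card
  set n := Nat.card k - 1 with hn
  have hq' : Nat.card k = n + 1 := by omega
  have key : (u - a) * ((u - a) ^ n - a ^ n) = u * (u ^ n - a ^ n) := by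
    have := sub_pow_card (k := k) u a
    rw [hq'] at this
    linear_combination this
  have hd : (u - a) ^ n - a ^ n ∉ O.nonunits := by
    refine notMem_nonunits_of_sub_mem (b := -a ^ n) (fun h => ha' ?_) ?_
    · refine mem_nonunits_of_pow_mem (n := n) (by omega) ?_
      rw [← neg_neg (a ^ n)]
      exact neg_mem h
    · rw [sub_neg_eq_add, sub_add_cancel]
      exact pow_mem_nonunits (by omega) hua
  have hd0 : (u - a) ^ n - a ^ n ≠ 0 := fun h => hd (h ▸ zero_mem _)
  have hdR := hinv _ (sub_mem (pow_mem (sub_mem hu ha) n) (pow_mem ha n)) hd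
  have e : u - a = ((u - a) ^ n - a ^ n)⁻¹ * u * (u ^ n - a ^ n) := by
    rw [mul_assoc, ← key]; field_simp
  rw [e]
  exact J.smul_mem ⟨_, mul_mem hdR hu⟩ h

/-- If `y` and `z` vanish modulo `J` and `u ≡ a`, then the relation `h` between consecutive ratios
becomes `u' ^ n ≡ -a`. -/
theorem pow_add_mem {J : Submodule R F} {n : ℕ} (hn : n ≠ 0) {y z u u' a : F}
    (hinv : ∀ d ∈ R, d ∉ O.nonunits → d⁻¹ ∈ R)
    (hyR : y ∈ R) (hzR : z ∈ R) (haR : a ∈ R)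
    (hy : y ∈ O.nonunits) (hz : z ∈ O.nonunits) (hyJ : y ∈ J) (hzJ : z ∈ J) (huJ : u - a ∈ J)
    (h : u' ^ n * ((1 + y) * (1 - z ^ n)) = -u * ((1 - y ^ n) * (1 + z))) :
    u' ^ n + a ∈ J := by
  have pw : ∀ t : F, t ^ n = t ^ (n - 1) * t := fun t => by
    rw [← pow_succ]; congr 1; omega
  have hynJ : y ^ n ∈ J := by
    rw [pw]; exact J.smul_mem ⟨_, pow_mem hyR _⟩ hyJ
  have hznJ : z ^ n ∈ J := by
    rw [pw]; exact J.smul_mem ⟨_, pow_mem hzR _⟩ hzJ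
  have h1 := one_add_notMem_nonunits hy
  have h2 := one_sub_pow_notMem_nonunits hn hz
  have h10 : 1 + y ≠ 0 := fun h => h1 (h ▸ zero_mem _)
  have h20 : 1 - z ^ n ≠ 0 := fun h => h2 (h ▸ zero_mem _)
  have h1R := hinv _ (add_mem (one_mem _) hyR) h1
  have h2R := hinv _ (sub_mem (one_mem _) (pow_mem hzR n)) h2
  have e : u' ^ n + a = ((1 + y)⁻¹ * (1 - z ^ n)⁻¹) *
      (-((1 - y ^ n) * (1 + z)) * (u - a) +
        (a * y + (-(a * (1 + y)) * z ^ n + (a * (1 + z) * y ^ n + -a * z)))) := by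
    field_simp
    linear_combination h
  have m : ∀ {r f : F}, r ∈ R → f ∈ J → r * f ∈ J := fun hr hf => J.smul_mem ⟨_, hr⟩ hf
  have h1' : (1 : F) ∈ R := one_mem _
  rw [e]
  refine m (mul_mem h1R h2R) (add_mem (m ?_ huJ) (add_mem (m haR hyJ) (add_mem (m ?_ hznJ)
    (add_mem (m ?_ hynJ) (m (neg_mem haR) hzJ)))))
  · exact neg_mem (mul_mem (sub_mem h1' (pow_mem hyR n)) (add_mem h1' hzR))
  · exact neg_mem (mul_mem haR (add_mem h1' hyR))
  · exact mul_mem haR (add_mem h1' hzR)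

end Branch

/-- The maximal ideal of a valuation ring, as a submodule of the field. -/
def nonunitsSubmodule {F : Type*} [Field F] (O : ValuationSubring F) :
    Submodule O.toSubring F where
  carrier := O.nonunits
  add_mem' := add_mem
  zero_mem' := zero_mem _
  smul_mem' r _ hf := mul_mem_nonunits r.2 hf

section SingleBranch

variable {k K F : Type*} [Field k] [Field K] [Field F] [Algebra k K] [Algebra k F]
  [Algebra K F] [IsScalarTower k K F] {w : ℕ → F} {N : ℕ} {O : ValuationSubring F} {β : k}

theorem algebraMap_mem_of_tower (hK : ∀ c : K, algebraMap K F c ∈ O) (c : k) :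
    algebraMap k F c ∈ O := by
  rw [IsScalarTower.algebraMap_apply k K F]
  exact hK _

theorem centered_mem_adjoin {S : Set F} (hS : ∀ i ≤ N, w i ∈ Algebra.adjoin K S) :
    ∀ i ≤ N, centered (algebraMap k F β) w i ∈ Algebra.adjoin K S := by
  intro i hi
  cases i with
  | zero =>
    refine sub_mem (hS 0 hi) ?_
    rw [IsScalarTower.algebraMap_apply k K F]
    exact Subalgebra.algebraMap_mem _ _
  | succ i => exact hS _ hi

theorem mem_of_centered_mem (hK : ∀ c : k, algebraMap k F c ∈ O) {i : ℕ}
    (h : centered (algebraMap k F β) w i ∈ O) : w i ∈ O := by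
  cases i with
  | zero => simpa [centered] using O.add_mem _ _ h (hK β)
  | succ i => exact h

theorem exists_sub_eq_centered (w : ℕ → F) (i : ℕ) :
    ∃ c : K, w i - algebraMap K F c = centered (algebraMap k F β) w i := by
  cases i with
  | zero => exact ⟨algebraMap k K β, by rw [← IsScalarTower.algebraMap_apply]; rfl⟩
  | succ i => exact ⟨0, by simp [centered]⟩

/-- Prolonging a branch by a further term is a totally ramified extension of degree `q - 1`: the
last local coordinate is a uniformizer, and so is `c`, the `(q - 1)`-st power of the new term. -/
theorem IsBranch.irreducible [Finite k] (hK : ∀ c : K, algebraMap K F c ∈ O)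
    (hw : IsBranch (Nat.card k) N w) (hβ : β ≠ -1) (h0 : w 0 - algebraMap k F β ∈ O.nonunits)
    (hfrac : ∀ f : F, ∃ r ∈ Algebra.adjoin K (w '' Set.Iic N),
      ∃ s ∈ Algebra.adjoin K (w '' Set.Iic N), f = r / s)
    (hN : centered (algebraMap k F β) w N ≠ 0) {c : F}
    (hc : c * (1 + w N) = w N - w N ^ Nat.card k) :
    Irreducible (Polynomial.X ^ (Nat.card k - 1) - Polynomial.C c : Polynomial F) := by
  have hq : 1 < Nat.card k := Finite.one_lt_card
  have hk := algebraMap_mem_of_tower (k := k) hK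
  have hcO := hw.centered_mem_nonunits hk hβ h0
  have hwS : ∀ i ≤ N, w i ∈ Algebra.adjoin K (w '' Set.Iic N) := fun i hi =>
    Algebra.subset_adjoin ⟨i, hi, rfl⟩
  have hsO := hcO N le_rfl
  obtain ⟨-, hτ⟩ := discrete_of_generators ((Set.finite_Iic N).image w) hfrac hK
    (by rintro _ ⟨i, hi, rfl⟩; exact mem_of_centered_mem hk (O.nonunits_subset (hcO i hi)))
    hsO (centered_mem_adjoin hwS N le_rfl) (by
      rintro _ ⟨i, hi, rfl⟩
      obtain ⟨c, hc⟩ := exists_sub_eq_centered (K := K) (β := β) w i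
      refine ⟨c, fun R hSR hRO hinv => ?_⟩
      rw [hc]
      refine hw.centered_mem_span hinv (fun i hi => hSR (hwS i hi)) ?_ hcO i hi
      rw [IsScalarTower.algebraMap_apply k K F]
      exact hSR (Subalgebra.algebraMap_mem _ _))
  set s := centered (algebraMap k F β) w N with hs
  rw [← centered_sub_pow β, ← hs] at hc
  have hsq : s - s ^ Nat.card k = s * (1 - s ^ (Nat.card k - 1)) := by
    rw [mul_sub, mul_one, mul_pow_sub_one (by omega)]
  rw [hsq] at hc
  -- `c` is a unit times `s`: the factors `1 + w N` and `1 - s ^ (q - 1)` are units.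
  have hu := one_sub_pow_notMem_nonunits (n := Nat.card k - 1) (by omega) hsO
  have h1 : (1 + w N) ∉ O.nonunits := by
    exact hw.one_add_notMem_nonunits hk hβ h0 N le_rfl
  have hwO : w N ∈ O := mem_of_centered_mem hk (O.nonunits_subset hsO)
  refine irreducible_X_pow_sub_C_of_uniformizer hsO hτ ?_ ?_ (by omega)
  · refine mem_nonunits_of_mul_mem h1 ?_
    rw [mul_comm, hc, mul_comm]
    exact mul_mem_nonunits (sub_mem O.one_mem (pow_mem (O.nonunits_subset hsO) _)) hsO
  · rintro g hg rfl
    apply hu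
    have : 1 - s ^ (Nat.card k - 1) = (1 + w N) * g := by
      apply mul_left_cancel₀ hN
      linear_combination -hc
    rw [this]
    exact mul_mem_nonunits (O.add_mem _ _ O.one_mem hwO) hg

end SingleBranch

/-! ### Pairs of branches -/

/-- Two branches of length `N` that start at a common point: with `x_m = y_0`, the branch `y` is
`x_m, x_{m+1}, …` and the branch `z` is `-(x_m + 1), -(x_{m-1} + 1), …`. -/
structure IsBranchPair {F : Type*} [Field F] (q N : ℕ) (y z : ℕ → F) : Prop where
  left : IsBranch q N z
  right : IsBranch q N y
  zero : z 0 = -(1 + y 0)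
  left_ne_zero : ∀ i ≤ N, z i ≠ 0
  right_ne_zero : ∀ i ≤ N, y i ≠ 0

/-- The relation between consecutive ratios `u_i = y_i / -z_i`. -/
theorem IsBranchPair.ratio_succ {F : Type*} [Field F] {q N : ℕ} {y z : ℕ → F}
    (h : IsBranchPair (q) N y z)
    (hodd : Odd (q)) {i : ℕ} (hi : i < N) :
    (y (i + 1) / -z (i + 1)) ^ (q - 1) * ((1 + y i) * (1 - z i ^ (q - 1))) =
      -(y i / -z i) * ((1 - y i ^ (q - 1)) * (1 + z i)) := by
  have hy := h.right i hi
  have hz := h.left i hi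
  have hz0 := h.left_ne_zero i hi.le
  have hz1 := h.left_ne_zero (i + 1) hi
  have f : ∀ t : F, t - t ^ q = t * (1 - t ^ (q - 1)) := fun t => by
    rw [mul_sub, mul_one, mul_pow_sub_one (by have := hodd.pos; omega)]
  rw [f] at hy hz
  rw [div_pow, (Nat.Odd.sub_odd hodd odd_one).neg_pow]
  field_simp
  linear_combination z i * (1 - z i ^ (q - 1)) * hy - (1 - y i ^ (q - 1)) * y i * hz

section BranchPair

variable {k F : Type*} [Field k] [Field F] [Algebra k F]
  {y z : ℕ → F} {N : ℕ} {O : ValuationSubring F} {β : k}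

/-- The ratio `u_1 = y_1 / -z_1` satisfies `u_1 ^ (q - 1) = y_0 / (1 + y_0)`. -/
theorem IsBranchPair.ratio_one [Finite k] (h : IsBranchPair (Nat.card k) N y z)
    (hodd : Odd (Nat.card k)) (hN : 1 ≤ N) :
    (y 1 / -z 1) ^ (Nat.card k - 1) * (1 + y 0) = y 0 := by
  have hy := h.right 0 hN
  have hz := h.left 0 hN
  have hy0 := h.right_ne_zero 0 (by omega)
  have hz1 := h.left_ne_zero 1 hN
  have hq : 1 < Nat.card k := Finite.one_lt_card
  have e : z 0 ^ Nat.card k = -(1 + y 0 ^ Nat.card k) := by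
    have := sub_pow_card (k := k) (-1) (y 0)
    rw [hodd.neg_one_pow] at this
    rw [h.zero, neg_add', this]
    ring
  rw [e, h.zero] at hz
  rw [div_pow, (Nat.Odd.sub_odd hodd odd_one).neg_pow]
  field_simp
  simp only [zero_add] at hy hz
  linear_combination hy + hz

theorem IsBranchPair.left_zero_congr (h : IsBranchPair (Nat.card k) N y z)
    (h0 : y 0 - algebraMap k F β ∈ O.nonunits) :
    z 0 - algebraMap k F (-(1 + β)) ∈ O.nonunits := by
  have : z 0 - algebraMap k F (-(1 + β)) = -(y 0 - algebraMap k F β) := by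
    rw [h.zero, map_neg, map_add, map_one]; ring
  rw [this]
  exact neg_mem h0

theorem IsBranchPair.mem_nonunits [Finite k] (h : IsBranchPair (Nat.card k) N y z)
    (hk : ∀ c : k, algebraMap k F c ∈ O) (hβ0 : β ≠ 0) (hβ1 : β ≠ -1)
    (h0 : y 0 - algebraMap k F β ∈ O.nonunits) {i : ℕ} (hi : 1 ≤ i) (hiN : i ≤ N) :
    y i ∈ O.nonunits ∧ z i ∈ O.nonunits := by
  obtain ⟨i, rfl⟩ := Nat.exists_eq_add_of_le' hi
  exact ⟨h.right.centered_mem_nonunits hk hβ1 h0 (i + 1) hiN,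
    h.left.centered_mem_nonunits hk (fun h => hβ0 (by linear_combination -h))
      (h.left_zero_congr h0) (i + 1) hiN⟩

/-- The ratio `u_1` satisfies `u_1 ^ (q - 1) ≡ β / (1 + β)`. -/
theorem IsBranchPair.ratio_one_congr [Finite k] (h : IsBranchPair (Nat.card k) N y z)
    (hodd : Odd (Nat.card k)) (hN : 1 ≤ N) (hk : ∀ c : k, algebraMap k F c ∈ O) (hβ1 : β ≠ -1)
    (h0 : y 0 - algebraMap k F β ∈ O.nonunits) :
    (y 1 / -z 1) ^ (Nat.card k - 1) - algebraMap k F (β / (1 + β)) ∈ O.nonunits := by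
  have e := h.ratio_one hodd hN
  have h1 := h.right.one_add_notMem_nonunits hk hβ1 h0 0 (by omega)
  refine mem_nonunits_of_mul_mem h1 ?_
  have hβ : 1 + β ≠ 0 := fun h => hβ1 (by linear_combination h)
  have hβ' : algebraMap k F (1 + β) ≠ 0 := (map_ne_zero _).2 hβ
  have : (1 + y 0) * ((y 1 / -z 1) ^ (Nat.card k - 1) - algebraMap k F (β / (1 + β))) =
      algebraMap k F (1 / (1 + β)) * (y 0 - algebraMap k F β) := by
    rw [mul_sub, mul_comm, e, map_div₀, map_div₀, map_one]
    field_simp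
    rw [map_add, map_one]
    ring
  rw [this]
  exact mul_mem_nonunits (hk _) h0

/-- The ratios satisfy `u_{i+1} ^ (q - 1) ≡ -u_i` for `i ≥ 1`. -/
theorem IsBranchPair.ratio_succ_congr [Finite k] (h : IsBranchPair (Nat.card k) N y z)
    (hodd : Odd (Nat.card k)) (hk : ∀ c : k, algebraMap k F c ∈ O) (hβ0 : β ≠ 0) (hβ1 : β ≠ -1)
    (h0 : y 0 - algebraMap k F β ∈ O.nonunits) {i : ℕ} (hi : 1 ≤ i) (hiN : i < N) {a : F}
    (ha : a ∈ O) (hu : y i / -z i - a ∈ O.nonunits) :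
    (y (i + 1) / -z (i + 1)) ^ (Nat.card k - 1) + a ∈ O.nonunits := by
  have hq : 1 < Nat.card k := Finite.one_lt_card
  obtain ⟨hy, hz⟩ := h.mem_nonunits hk hβ0 hβ1 h0 hi hiN.le
  exact pow_add_mem (J := nonunitsSubmodule O) (by omega)
    (fun d _ hd => inv_mem_of_notMem_nonunits hd) (O.nonunits_subset hy) (O.nonunits_subset hz) ha
    hy hz hy hz hu (h.ratio_succ hodd hiN)

end BranchPair

/-! ### Central places: residue field and uniqueness -/

/-- The functions `y_i`, `z_i` (`i ≤ N`) and the ratios `y_i / -z_i` (`1 ≤ i ≤ N`) of a pair of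
branches. -/
def pairGenerators {F : Type*} [Field F] (N : ℕ) (y z : ℕ → F) : Set F :=
  y '' Set.Iic N ∪ z '' Set.Iic N ∪ (fun i => y i / -z i) '' Set.Icc 1 N

theorem pairGenerators_finite {F : Type*} [Field F] (N : ℕ) (y z : ℕ → F) :
    (pairGenerators N y z).Finite :=
  (((Set.finite_Iic N).image y).union ((Set.finite_Iic N).image z)).union
    ((Set.finite_Icc 1 N).image _)

/-- The valuation ring `O` contains `K`, and at it `y_0` has the value `-1/2` and the ratios
`y_i / -z_i` of a pair of branches have the values `α_i`, for `1 ≤ i ≤ N`. -/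
structure IsCentralAt {K F : Type*} [Field K] [Field F] [Algebra K F] (O : ValuationSubring F)
    (N : ℕ) (y z : ℕ → F) (α : ℕ → K) : Prop where
  algebraMap_mem : ∀ c : K, algebraMap K F c ∈ O
  zero : y 0 - algebraMap K F (-1 / 2) ∈ O.nonunits
  ratio : ∀ i, 1 ≤ i → i ≤ N → y i / -z i - algebraMap K F (α i) ∈ O.nonunits

/-- The recursion `α_0 = 1`, `α_{i+1} ^ (q - 1) = -α_i` that the values of the ratios satisfy. -/
structure IsResidueChain {K : Type*} [Field K] (q N : ℕ) (α : ℕ → K) : Prop where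
  zero : α 0 = 1
  succ : ∀ i < N, α (i + 1) ^ (q - 1) = -α i

theorem IsResidueChain.ne_zero {K : Type*} [Field K] {q N : ℕ} {α : ℕ → K}
    (h : IsResidueChain q N α) (hq : 1 < q) : ∀ i ≤ N, α i ≠ 0 := by
  intro i hi
  induction i with
  | zero => rw [h.zero]; exact one_ne_zero
  | succ i ih =>
    intro h0
    have := h.succ i hi
    rw [h0, zero_pow (by omega), eq_comm, neg_eq_zero] at this
    exact ih (by omega) this

theorem neg_half_ne_zero {k : Type*} [Field k] (h2 : (2 : k) ≠ 0) : (-1 / 2 : k) ≠ 0 :=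
  div_ne_zero (neg_ne_zero.2 one_ne_zero) h2

theorem neg_half_ne_neg_one {k : Type*} [Field k] (h2 : (2 : k) ≠ 0) : (-1 / 2 : k) ≠ -1 := by
  intro h
  rw [div_eq_iff h2] at h
  exact one_ne_zero (α := k) (by linear_combination h)

theorem algebraMap_neg_half (k K F : Type*) [Field k] [Field K] [Field F] [Algebra k F]
    [Algebra K F] :
    algebraMap K F (-1 / 2) = algebraMap k F (-1 / 2) := by
  rw [map_div₀, map_div₀, map_neg, map_neg, map_one, map_one, map_ofNat, map_ofNat]

theorem IsCentralAt.zero_of_tower {k K F : Type*} [Field k] [Field K] [Field F] [Algebra k F]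
    [Algebra K F] {y z : ℕ → F} {N : ℕ} {O : ValuationSubring F} {α : ℕ → K}
    (hO : IsCentralAt O N y z α) :
    y 0 - algebraMap k F (-1 / 2) ∈ O.nonunits := by
  rw [← algebraMap_neg_half k K F]
  exact hO.zero

section Central

variable {k K F : Type*} [Field k] [Finite k] [Field K] [Field F] [Algebra k K] [Algebra k F]
  [Algebra K F] [IsScalarTower k K F] {y z : ℕ → F} {N : ℕ} {O : ValuationSubring F} {α : ℕ → K}

theorem IsBranchPair.subset_of_isCentralAt (h : IsBranchPair (Nat.card k) N y z)
    (h2 : (2 : k) ≠ 0) (hO : IsCentralAt O N y z α) : pairGenerators N y z ⊆ O := by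
  have hk := algebraMap_mem_of_tower (k := k) hO.algebraMap_mem
  have hm := fun i hi hiN => h.mem_nonunits (i := i) hk (neg_half_ne_zero h2)
    (neg_half_ne_neg_one h2) hO.zero_of_tower hi hiN
  have h0 : y 0 ∈ O := mem_of_sub_mem_nonunits (hO.algebraMap_mem _) hO.zero
  rintro _ ((⟨i, hi, rfl⟩ | ⟨i, hi, rfl⟩) | ⟨i, hi, rfl⟩)
  · rcases Nat.eq_zero_or_pos i with rfl | hi'
    · exact h0
    · exact O.nonunits_subset (hm i hi' hi).1
  · rcases Nat.eq_zero_or_pos i with rfl | hi'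
    · rw [h.zero]
      exact O.neg_mem _ (O.add_mem _ _ O.one_mem h0)
    · exact O.nonunits_subset (hm i hi' hi).2
  · exact mem_of_sub_mem_nonunits (hO.algebraMap_mem (α i)) (hO.ratio i hi.1 hi.2)

/-- The last function `y_N` divides every generator minus its value: by the branch equation for
the `y_i` and the `z_i`, and by induction on `i` for the ratios. -/
theorem IsBranchPair.mem_span (h : IsBranchPair (Nat.card k) N y z) (hodd : Odd (Nat.card k))
    (h2 : (2 : k) ≠ 0) (hN : 1 ≤ N) (hα : IsResidueChain (Nat.card k) N α)
    (hO : IsCentralAt O N y z α) {R : Subring F} (hKR : ∀ c : K, algebraMap K F c ∈ R)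
    (hSR : pairGenerators N y z ⊆ R) (hinv : ∀ d ∈ R, d ∉ O.nonunits → d⁻¹ ∈ R) :
    y 0 - algebraMap K F (-1 / 2) ∈ Submodule.span R {y N} ∧
      ∀ i, 1 ≤ i → i ≤ N → y i ∈ Submodule.span R {y N} ∧ z i ∈ Submodule.span R {y N} ∧
        y i / -z i - algebraMap K F (α i) ∈ Submodule.span R {y N} := by
  have hq : 1 < Nat.card k := Finite.one_lt_card
  have hk := algebraMap_mem_of_tower (k := k) hO.algebraMap_mem
  have hm := fun i hi hiN => h.mem_nonunits (i := i) hk (neg_half_ne_zero h2)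
    (neg_half_ne_neg_one h2) hO.zero_of_tower hi hiN
  have hyR : ∀ i ≤ N, y i ∈ R := fun i hi => hSR (.inl (.inl ⟨i, hi, rfl⟩))
  have hzR : ∀ i ≤ N, z i ∈ R := fun i hi => hSR (.inl (.inr ⟨i, hi, rfl⟩))
  have huR : ∀ i, 1 ≤ i → i ≤ N → y i / -z i ∈ R := fun i hi hiN => hSR (.inr ⟨i, ⟨hi, hiN⟩, rfl⟩)
  obtain ⟨N, rfl⟩ := Nat.exists_eq_add_of_le' hN
  have hc := h.right.centered_mem_span hinv hyR
    (by rw [← algebraMap_neg_half k K F]; exact hKR _)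
    (h.right.centered_mem_nonunits hk (neg_half_ne_neg_one h2) hO.zero_of_tower)
  set J := Submodule.span R {y (N + 1)} with hJ
  have m : ∀ {r f : F}, r ∈ R → f ∈ J → r * f ∈ J := fun hr hf => J.smul_mem ⟨_, hr⟩ hf
  have hJ0 : y 0 - algebraMap K F (-1 / 2) ∈ J := by
    rw [algebraMap_neg_half k K F]
    exact hc 0 (by omega)
  have hJy : ∀ i, 1 ≤ i → i ≤ N + 1 → y i ∈ J := by
    intro i hi hiN
    obtain ⟨i, rfl⟩ := Nat.exists_eq_add_of_le' hi
    exact hc (i + 1) hiN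
  have hαO : ∀ i ≤ N + 1, algebraMap K F (α i) ∉ O.nonunits := fun i hi =>
    algebraMap_notMem_nonunits hO.algebraMap_mem (hα.ne_zero hq i hi)
  have huO : ∀ i, 1 ≤ i → i ≤ N + 1 → y i / -z i ∉ O.nonunits := fun i hi hiN =>
    notMem_nonunits_of_sub_mem (hαO i hiN) (hO.ratio i hi hiN)
  have hJz : ∀ i, 1 ≤ i → i ≤ N + 1 → z i ∈ J := by
    intro i hi hiN
    have e : z i = -(y i / -z i)⁻¹ * y i := by
      have := h.left_ne_zero i hiN
      have := h.right_ne_zero i hiN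
      field_simp
    rw [e]
    exact m (neg_mem (hinv _ (huR i hi hiN) (huO i hi hiN))) (hJy i hi hiN)
  refine ⟨hJ0, fun i hi hiN => ⟨hJy i hi hiN, hJz i hi hiN, ?_⟩⟩
  have key : ∀ i ≤ N, (y (i + 1) / -z (i + 1)) ^ (Nat.card k - 1) + algebraMap K F (α i) ∈ J →
      y (i + 1) / -z (i + 1) - algebraMap K F (α (i + 1)) ∈ J := by
    intro i hi hJi
    refine sub_mem_of_pow_sub_pow_mem (k := k) hinv (huR _ (by omega) (by omega)) (hKR _)
      (hαO _ (by omega)) (hO.ratio _ (by omega) (by omega)) ?_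
    rw [← map_pow, hα.succ i (by omega), map_neg, sub_neg_eq_add]
    exact hJi
  induction i, hi using Nat.le_induction with
  | base =>
    refine key 0 (by omega) ?_
    have e := h.ratio_one hodd (by omega)
    have h1 := h.right.one_add_notMem_nonunits hk (neg_half_ne_neg_one h2) hO.zero_of_tower 0
      (by omega)
    have h10 : 1 + y 0 ≠ 0 := fun h => h1 (h ▸ zero_mem _)
    have h2F : (2 : F) ≠ 0 := by
      have := (map_ne_zero (algebraMap k F)).2 h2
      rwa [map_ofNat] at this
    have e' : (y (0 + 1) / -z (0 + 1)) ^ (Nat.card k - 1) + algebraMap K F (α 0) =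
        (1 + y 0)⁻¹ * 2 * (y 0 - algebraMap K F (-1 / 2)) := by
      rw [hα.zero, map_one, map_div₀, map_neg, map_one, map_ofNat, zero_add]
      field_simp
      linear_combination e
    rw [e']
    have h2R : (2 : F) ∈ R := by
      have := hKR 2
      rwa [map_ofNat] at this
    exact m (mul_mem (hinv _ (add_mem (one_mem _) (hyR 0 (by omega))) h1) h2R) hJ0
  | succ i hi ih =>
    refine key i (by omega) ?_
    obtain ⟨hy, hz⟩ := hm i hi (by omega)
    exact pow_add_mem (by omega) hinv (hyR i (by omega)) (hzR i (by omega)) (hKR _) hy hz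
      (hJy i hi (by omega)) (hJz i hi (by omega)) (ih (by omega))
      (h.ratio_succ hodd (by omega))

/-- The values of the generators, and the multiples of `y_N` they differ from them by, for all
central valuation rings at once. -/
theorem IsBranchPair.exists_const (h : IsBranchPair (Nat.card k) N y z) (hodd : Odd (Nat.card k))
    (h2 : (2 : k) ≠ 0) (hN : 1 ≤ N) (hα : IsResidueChain (Nat.card k) N α)
    {s : F} (hs : s ∈ pairGenerators N y z) :
    ∃ c : K, ∀ O : ValuationSubring F, IsCentralAt O N y z α → ∀ R : Subring F,
      (∀ c : K, algebraMap K F c ∈ R) → pairGenerators N y z ⊆ R →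
      (∀ d ∈ R, d ∉ O.nonunits → d⁻¹ ∈ R) →
        s - algebraMap K F c ∈ Submodule.span R {y N} := by
  have h2K : (2 : K) ≠ 0 := by
    have := (map_ne_zero (algebraMap k K)).2 h2
    rwa [map_ofNat] at this
  have key := fun O (hO : IsCentralAt O N y z α) R hKR hSR hinv =>
    h.mem_span (O := O) (R := R) hodd h2 hN hα hO hKR hSR hinv
  rcases hs with (⟨i, hi, rfl⟩ | ⟨i, hi, rfl⟩) | ⟨i, hi, rfl⟩
  · rcases Nat.eq_zero_or_pos i with rfl | hi'
    · exact ⟨-1 / 2, fun O hO R hKR hSR hinv => (key O hO R hKR hSR hinv).1⟩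
    · refine ⟨0, fun O hO R hKR hSR hinv => ?_⟩
      rw [map_zero, sub_zero]
      exact ((key O hO R hKR hSR hinv).2 i hi' hi).1
  · rcases Nat.eq_zero_or_pos i with rfl | hi'
    · refine ⟨-1 / 2, fun O hO R hKR hSR hinv => ?_⟩
      have e : z 0 - algebraMap K F (-1 / 2) = -(y 0 - algebraMap K F (-1 / 2)) := by
        have : (-1 / 2 : K) + (-1 / 2) = -1 := by field_simp; norm_num
        have := congrArg (algebraMap K F) this
        rw [map_add, map_neg, map_one] at this
        rw [h.zero]
        linear_combination -this
      rw [e]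
      exact neg_mem (key O hO R hKR hSR hinv).1
    · refine ⟨0, fun O hO R hKR hSR hinv => ?_⟩
      rw [map_zero, sub_zero]
      exact ((key O hO R hKR hSR hinv).2 i hi' hi).2.1
  · exact ⟨α i, fun O hO R hKR hSR hinv => ((key O hO R hKR hSR hinv).2 i hi.1 hi.2).2.2⟩

theorem IsBranchPair.span_le (h : IsBranchPair (Nat.card k) N y z) (h2 : (2 : k) ≠ 0)
    (hN : 1 ≤ N) (hO : IsCentralAt O N y z α) :
    Submodule.span O.toSubring {y N} ≤ nonunitsSubmodule O := by
  rw [Submodule.span_singleton_le_iff_mem]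
  exact (h.mem_nonunits (algebraMap_mem_of_tower (k := k) hO.algebraMap_mem) (neg_half_ne_zero h2)
    (neg_half_ne_neg_one h2) hO.zero_of_tower hN le_rfl).1

theorem IsBranchPair.fractions (h : IsBranchPair (Nat.card k) N y z) (hodd : Odd (Nat.card k))
    (h2 : (2 : k) ≠ 0) (hN : 1 ≤ N) (hα : IsResidueChain (Nat.card k) N α)
    (hO : IsCentralAt O N y z α)
    (hfrac : ∀ f : F, ∃ r ∈ Algebra.adjoin K (pairGenerators N y z),
      ∃ s ∈ Algebra.adjoin K (pairGenerators N y z), f = r / s) :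
    ∀ f ∈ O, ∃ b ∈ Algebra.adjoin K (pairGenerators N y z),
      ∃ d ∈ Algebra.adjoin K (pairGenerators N y z), d ∉ O.nonunits ∧ f = b / d := by
  refine (discrete_of_generators (pairGenerators_finite N y z) hfrac hO.algebraMap_mem
    (h.subset_of_isCentralAt h2 hO) (h.span_le h2 hN hO (Submodule.mem_span_singleton_self _))
    (Algebra.subset_adjoin (.inl (.inl ⟨N, le_refl N, rfl⟩))) fun s hs => ?_).1
  obtain ⟨c, hc⟩ := h.exists_const hodd h2 hN hα hs
  exact ⟨c, fun R hSR _ hinv => hc O hO R (fun c => hSR (Subalgebra.algebraMap_mem _ _))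
    (fun s hs => hSR (Algebra.subset_adjoin hs)) hinv⟩

/-- `K` is the residue field at a central place. -/
theorem IsBranchPair.exists_congr (h : IsBranchPair (Nat.card k) N y z) (hodd : Odd (Nat.card k))
    (h2 : (2 : k) ≠ 0) (hN : 1 ≤ N) (hα : IsResidueChain (Nat.card k) N α)
    (hO : IsCentralAt O N y z α)
    (hfrac : ∀ f : F, ∃ r ∈ Algebra.adjoin K (pairGenerators N y z),
      ∃ s ∈ Algebra.adjoin K (pairGenerators N y z), f = r / s) {f : F} (hf : f ∈ O) :
    ∃ c : K, f - algebraMap K F c ∈ O.nonunits := by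
  have hSO := h.subset_of_isCentralAt h2 hO
  refine exists_const_of_fractions hO.algebraMap_mem hSO (fun s hs => ?_)
    (h.fractions hodd h2 hN hα hO hfrac) hf
  obtain ⟨c, hc⟩ := h.exists_const hodd h2 hN hα hs
  exact ⟨c, h.span_le h2 hN hO (hc O hO O.toSubring hO.algebraMap_mem hSO
    fun d _ hd => inv_mem_of_notMem_nonunits hd)⟩

/-- A central place is determined by the values of the ratios. -/
theorem IsBranchPair.le_of_isCentralAt (h : IsBranchPair (Nat.card k) N y z)
    (hodd : Odd (Nat.card k)) (h2 : (2 : k) ≠ 0) (hN : 1 ≤ N)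
    (hα : IsResidueChain (Nat.card k) N α) {O' : ValuationSubring F}
    (hO : IsCentralAt O N y z α) (hO' : IsCentralAt O' N y z α)
    (hfrac : ∀ f : F, ∃ r ∈ Algebra.adjoin K (pairGenerators N y z),
      ∃ s ∈ Algebra.adjoin K (pairGenerators N y z), f = r / s) : O ≤ O' := by
  have hSO := h.subset_of_isCentralAt h2 hO
  have hSO' := h.subset_of_isCentralAt h2 hO'
  refine le_of_fractions hO.algebraMap_mem hO'.algebraMap_mem hSO hSO' (fun s hs => ?_)
    (h.fractions hodd h2 hN hα hO hfrac)
  obtain ⟨c, hc⟩ := h.exists_const hodd h2 hN hα hs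
  exact ⟨c, h.span_le h2 hN hO (hc O hO O.toSubring hO.algebraMap_mem hSO
    fun d _ hd => inv_mem_of_notMem_nonunits hd),
    h.span_le h2 hN hO' (hc O' hO' O'.toSubring hO'.algebraMap_mem hSO'
    fun d _ hd => inv_mem_of_notMem_nonunits hd)⟩

end Central

/-! ### Counting the residue tuples -/

section Counting

/-- The tuples `(a_1, …, a_s)` with `r i a_i a_{i+1}` for `i < s`, where `a_0 = 1`. -/
def relationTuples {K : Type*} [Field K] (r : ℕ → K → K → Prop) (s : ℕ) : Set (Fin s → K) :=
  {a | ∀ i < s, r i (tupleEntry a i) (tupleEntry a (i + 1))}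

theorem tupleEntry_init {K : Type*} [Field K] {s : ℕ} (a : Fin (s + 1) → K) {i : ℕ} (hi : i ≤ s) :
    tupleEntry (Fin.init a : Fin s → K) i = tupleEntry a i := by
  cases i with
  | zero => rfl
  | succ i =>
    simp only [tupleEntry]
    rw [dif_pos (show i < s by omega), dif_pos (show i < s + 1 by omega)]
    rfl

theorem tupleEntry_last {K : Type*} [Field K] {s : ℕ} (a : Fin (s + 1) → K) :
    tupleEntry a (s + 1) = a (Fin.last s) := by
  simp only [tupleEntry]
  rw [dif_pos (Nat.lt_succ_self s)]
  rfl

theorem tupleEntry_ofSequence {K : Type*} [Field K] {s : ℕ} {a : ℕ → K} (h0 : a 0 = 1) {i : ℕ}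
    (hi : i ≤ s) : tupleEntry (fun j : Fin s => a (j + 1)) i = a i := by
  cases i with
  | zero => exact h0.symm
  | succ i =>
    simp only [tupleEntry]
    rw [dif_pos (show i < s by omega)]

/-- A tuple of length `s + 1` is a tuple of length `s` with an admissible last entry. -/
def relationTuplesEquiv {K : Type*} [Field K] (r : ℕ → K → K → Prop) (s : ℕ) :
    relationTuples r (s + 1) ≃ Σ a : relationTuples r s, {b | r s (tupleEntry a.1 s) b} where
  toFun a := ⟨⟨Fin.init a.1, fun i hi => by
      rw [tupleEntry_init _ hi.le, tupleEntry_init _ hi]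
      exact a.2 i (by omega)⟩, ⟨a.1 (Fin.last s), by
      have := a.2 s (by omega)
      rw [tupleEntry_last] at this
      change r s (tupleEntry (Fin.init a.1 : Fin s → K) s) _
      rwa [tupleEntry_init _ le_rfl]⟩⟩
  invFun p := ⟨Fin.snoc (α := fun _ => K) p.1.1 p.2.1, fun i hi => by
    have hinit : (Fin.init (Fin.snoc (α := fun _ => K) p.1.1 p.2.1) : Fin s → K) = p.1.1 :=
      Fin.init_snoc _ _
    rw [← tupleEntry_init _ (Nat.lt_succ_iff.1 hi), hinit]
    rcases (Nat.lt_succ_iff.1 hi).eq_or_lt with rfl | hi'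
    · rw [tupleEntry_last, Fin.snoc_last]
      exact p.2.2
    · rw [← tupleEntry_init _ hi', hinit]
      exact p.1.2 i hi'⟩
  left_inv a := Subtype.ext (Fin.snoc_init_self a.1)
  right_inv p := by
    obtain ⟨⟨a, ha⟩, ⟨b, hb⟩⟩ := p
    have h1 : (Fin.init (Fin.snoc (α := fun _ => K) a b) : Fin s → K) = a := Fin.init_snoc _ _
    have h2 : (Fin.snoc (α := fun _ => K) a b : Fin (s + 1) → K) (Fin.last s) = b :=
      Fin.snoc_last _ _
    refine Sigma.subtype_ext (Subtype.ext h1) h2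

theorem ncard_relationTuples_succ {K : Type*} [Field K] [Finite K] {r : ℕ → K → K → Prop} {s c : ℕ}
    (h : ∀ a ∈ relationTuples r s, {b | r s (tupleEntry a s) b}.ncard = c) :
    (relationTuples r (s + 1)).ncard = (relationTuples r s).ncard * c := by
  cases nonempty_fintype (relationTuples r s)
  rw [← Nat.card_coe_set_eq, Nat.card_congr (relationTuplesEquiv r s), Nat.card_sigma]
  rw [Finset.sum_congr rfl (fun a _ => (Nat.card_coe_set_eq _).trans (h a.1 a.2))]
  rw [Finset.sum_const, Finset.card_univ, smul_eq_mul, ← Nat.card_eq_fintype_card,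
    Nat.card_coe_set_eq]

theorem ncard_relationTuples_zero {K : Type*} [Field K] (r : ℕ → K → K → Prop) :
    (relationTuples r 0).ncard = 1 := by
  have : relationTuples r 0 = Set.univ := Set.eq_univ_of_forall fun a i hi => absurd hi (by omega)
  rw [this, Set.ncard_univ, Nat.card_unique]

end Counting

section Quadratic

theorem pow_sub_one_mul_add_one {K : Type*} [Field K] {q : ℕ} (hq : 1 < q)
    (hK : Nat.card K = q ^ 2) {a : K} (ha : a ≠ 0) : (a ^ (q - 1)) ^ (q + 1) = 1 := by
  have : Finite K := Nat.finite_of_card_ne_zero (by rw [hK]; positivity)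
  cases nonempty_fintype K
  have h := FiniteField.pow_card_sub_one_eq_one a ha
  rw [← Nat.card_eq_fintype_card, hK] at h
  rw [← pow_mul, ← h]
  congr 1
  rw [mul_comm, ← Nat.sq_sub_sq, one_pow]

variable {k K : Type*} [Field k] [Finite k] [Field K] [Algebra k K] {q : ℕ}

/-- The `(q - 1)`-st powers in the cyclic group `Kˣ` of order `(q - 1) (q + 1)` are the elements of
order dividing `q + 1`. -/
theorem exists_pow_sub_one_eq {K : Type*} [Field K] {q : ℕ} (hq : 1 < q)
    (hK : Nat.card K = q ^ 2) {c : K} (hc : c ^ (q + 1) = 1) : ∃ b : K, b ^ (q - 1) = c := by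
  have : Finite K := Nat.finite_of_card_ne_zero (by rw [hK]; positivity)
  have hc0 : c ≠ 0 := by
    rintro rfl
    rw [zero_pow (by omega)] at hc
    exact zero_ne_one hc
  obtain ⟨g, hg⟩ := IsCyclic.exists_generator (α := Kˣ)
  obtain ⟨j, hj⟩ := (mem_powers_iff_mem_zpowers.2 (hg (Units.mk0 c hc0)))
  have hj : g ^ j = Units.mk0 c hc0 := hj
  have h1 : orderOf g = (q + 1) * (q - 1) := by
    rw [orderOf_eq_card_of_forall_mem_zpowers hg, Nat.card_units, hK,
      ← Nat.sq_sub_sq, one_pow]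
  have h2 : g ^ ((q + 1) * j) = 1 := by
    rw [mul_comm, pow_mul, hj]
    exact Units.ext (by simpa using hc)
  have h3 := orderOf_dvd_of_pow_eq_one h2
  rw [h1] at h3
  obtain ⟨l, rfl⟩ := Nat.dvd_of_mul_dvd_mul_left (by omega) h3
  refine ⟨(g ^ l : Kˣ), ?_⟩
  rw [← Units.val_pow_eq_pow_val, ← pow_mul, mul_comm, hj, Units.val_mk0]

theorem ncard_pow_sub_one_eq (hk : Nat.card k = q) (hK : Nat.card K = q ^ 2) {c : K}
    (hc : c ^ (q + 1) = 1) : {b : K | b ^ (q - 1) = c}.ncard = q - 1 := by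
  have hq : 1 < q := hk ▸ Finite.one_lt_card
  obtain ⟨b, rfl⟩ := exists_pow_sub_one_eq hq hK hc
  have hb : b ≠ 0 := by
    rintro rfl
    rw [zero_pow (by omega), zero_pow (by omega)] at hc
    exact zero_ne_one hc
  have e : {b' : K | b' ^ (q - 1) = b ^ (q - 1)} =
      (fun ζ : k => b * algebraMap k K ζ) '' {0}ᶜ := by
    ext b'
    simp only [Set.mem_ofPred_eq, Set.mem_image, Set.mem_compl_iff, Set.mem_singleton_iff]
    constructor
    · intro h
      have h1 : (b' / b) ^ (q - 1) = 1 := by rw [div_pow, h, div_self (pow_ne_zero _ hb)]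
      obtain ⟨ζ, hζ⟩ := exists_eq_algebraMap_of_pow_card_eq (k := k) (r := b' / b) (by
        rw [hk, ← mul_pow_sub_one (by omega : q ≠ 0), h1, mul_one])
      refine ⟨ζ, ?_, ?_⟩
      · rintro rfl
        rw [hζ, map_zero, zero_pow (by omega)] at h1
        exact zero_ne_one h1
      · rw [← hζ]; field_simp
    · rintro ⟨ζ, hζ, rfl⟩
      cases nonempty_fintype k
      rw [mul_pow, ← map_pow, ← hk, Nat.card_eq_fintype_card,
        FiniteField.pow_card_sub_one_eq_one ζ hζ, map_one, mul_one]
  rw [e, Set.ncard_image_of_injective _ fun x y h =>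
    (algebraMap k K).injective (mul_left_cancel₀ hb h), Set.ncard_compl, Set.ncard_singleton, hk]

theorem ncard_sq_eq {K : Type*} [Field K] {q : ℕ} (hq : 1 < q) (hK : Nat.card K = q ^ 2)
    (hodd : Odd q) (h2 : (2 : K) ≠ 0) {c : K} (hc : c ^ (q + 1) = 1) :
    {b : K | b ^ 2 = c}.ncard = 2 := by
  obtain ⟨b, rfl⟩ := exists_pow_sub_one_eq hq hK hc
  obtain ⟨j, hj⟩ := hodd
  have hb : b ≠ 0 := by
    rintro rfl
    rw [zero_pow (by omega), zero_pow (by omega)] at hc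
    exact zero_ne_one hc
  have e : {b' : K | b' ^ 2 = b ^ (q - 1)} = {b ^ j, -b ^ j} := by
    ext b'
    rw [Set.mem_ofPred_eq, Set.mem_insert_iff, Set.mem_singleton_iff, ← sq_eq_sq_iff_eq_or_eq_neg,
      ← pow_mul, hj, Nat.add_sub_cancel, mul_comm]
  rw [e, Set.ncard_pair]
  intro h
  have : 2 * b ^ j = 0 := by linear_combination h
  exact (mul_ne_zero h2 (pow_ne_zero _ hb)) this

/-- Here `a_i` is a root of unity of order dividing `2 ^ (i + 1)`. -/
theorem pow_add_one_eq_one_of_sq {t : ℕ} (ht : 2 ^ t ∣ q + 1) {a : ℕ → K} (h0 : a 0 = 1) {s : ℕ}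
    (hs : s < t) (h : ∀ i < s, a (i + 1) ^ 2 = -1 / a i) : ∀ i ≤ s, a i ^ (q + 1) = 1 := by
  have key : ∀ i ≤ s, a i ^ 2 ^ (i + 1) = 1 := by
    intro i hi
    induction i with
    | zero => rw [h0, one_pow]
    | succ i ih =>
      rw [pow_succ' 2 (i + 1), pow_mul, h i (by omega), div_pow, ih (by omega), div_one]
      exact (even_two.pow_of_ne_zero (by omega)).neg_one_pow
  intro i hi
  obtain ⟨c, hc⟩ := (pow_dvd_pow 2 (show i + 1 ≤ t by omega)).trans ht
  rw [hc, pow_mul, key i hi, one_pow]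

/-- The conditions on a tuple amount to `α_{i+1} ^ (q - 1) = -α_i` for all `i`. Given these, an
entry `α_i` with `i < t` has `-α_i` as a `(q - 1)`-st power, so `α_i ^ (q + 1) = 1` and `α_i ^ 2 =
α_i ^ (1 - q) = -1 / α_{i-1}`; conversely `α_i ^ (q + 1) = 1` holds because `2 ^ t` divides `q +
1`. -/
theorem isResidueChain_tupleEntry_iff {K : Type*} [Field K] {q : ℕ} (hq : 1 < q)
    (hK : Nat.card K = q ^ 2) (hodd : Odd q) {t : ℕ} (ht : 1 ≤ t) (hqt : 2 ^ t ∣ q + 1)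
    {α : Fin t → K} :
    IsResidueChain q t (tupleEntry α) ↔ α ∈ residueTuples q K t := by
  have hpow : ∀ a : K, a ^ (q + 1) = a ^ (q - 1) * a ^ 2 := fun a => by
    rw [← pow_add]; congr 1; omega
  constructor
  · intro h
    refine ⟨fun i hi hit => ?_, ?_⟩
    · have hne := h.ne_zero hq
      have h1 : tupleEntry α i ^ (q + 1) = 1 := by
        have := pow_sub_one_mul_add_one hq hK (hne (i + 1) hit)
        rwa [h.succ i hit, (hodd.add_odd odd_one).neg_pow] at this
      have h3 := h.succ (i - 1) (by omega)
      rw [Nat.sub_add_cancel hi] at h3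
      rw [hpow, h3] at h1
      have := hne (i - 1) (by omega)
      field_simp
      linear_combination -h1
    · have h3 := h.succ (t - 1) (by omega)
      rwa [Nat.sub_add_cancel ht] at h3
  · rintro ⟨h1, h2⟩
    refine ⟨rfl, fun i hi => ?_⟩
    have h3 := pow_add_one_eq_one_of_sq hqt (a := tupleEntry α) rfl (s := t - 1) (by omega)
      (fun i hi => h1 (i + 1) (by omega) (by omega))
    rcases (show i + 1 ≤ t from hi).eq_or_lt with rfl | hi'
    · exact h2
    · have h4 := h3 (i + 1) (by omega)
      have h5 := h3 i (by omega)
      have h0 : tupleEntry α i ≠ 0 := by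
        intro h0
        rw [h0, zero_pow (by omega)] at h5
        exact zero_ne_one h5
      rw [hpow, h1 (i + 1) (by omega) hi', Nat.add_sub_cancel] at h4
      field_simp at h4
      linear_combination -h4

theorem ncard_residueTuples (hk : Nat.card k = q) (hK : Nat.card K = q ^ 2) (hodd : Odd q)
    (h2 : (2 : K) ≠ 0) {t : ℕ} (ht : 1 ≤ t) (hqt : 2 ^ t ∣ q + 1) :
    (residueTuples q K t).ncard = 2 ^ (t - 1) * (q - 1) := by
  have : Finite K := Nat.finite_of_card_ne_zero (by
    rw [hK]; exact pow_ne_zero _ hodd.pos.ne')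
  obtain ⟨t, rfl⟩ := Nat.exists_eq_add_of_le' ht
  set r : ℕ → K → K → Prop := fun i a b => if i < t then b ^ 2 = -1 / a else b ^ (q - 1) = -a
    with hr
  have e : residueTuples q K (t + 1) = relationTuples r (t + 1) := by
    ext α
    constructor
    · rintro ⟨h1, h3⟩ i hi
      by_cases h : i < t
      · rw [hr]
        simp only [h, if_true]
        exact h1 (i + 1) (by omega) (by omega)
      · obtain rfl : i = t := by omega
        rw [hr]
        simp only [h, if_false]
        exact h3
    · intro h
      refine ⟨fun i hi hit => ?_, ?_⟩
      · have h3 := h (i - 1) (by omega)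
        rw [hr] at h3
        simp only [show i - 1 < t by omega, if_true, Nat.sub_add_cancel hi] at h3
        exact h3
      · have h3 := h t (by omega)
        rw [hr] at h3
        simp only [lt_irrefl, if_false] at h3
        exact h3
  have hpow : ∀ s ≤ t, ∀ α ∈ relationTuples r s, tupleEntry α s ^ (q + 1) = 1 := by
    intro s hs α hα
    refine pow_add_one_eq_one_of_sq hqt (a := tupleEntry α) rfl (s := s) (by omega)
      (fun i hi => ?_) s le_rfl
    have h3 := hα i hi
    rw [hr] at h3
    simp only [show i < t by omega, if_true] at h3
    exact h3
  have hneg : ∀ a : K, a ^ (q + 1) = 1 → (-a) ^ (q + 1) = 1 := fun a ha => by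
    rw [(hodd.add_odd odd_one).neg_pow, ha]
  have hcount : ∀ s ≤ t, (relationTuples r s).ncard = 2 ^ s := by
    intro s hs
    induction s with
    | zero => exact ncard_relationTuples_zero r
    | succ s ih =>
      rw [ncard_relationTuples_succ (c := 2), ih (by omega), pow_succ]
      intro α hα
      simp only [hr, show s < t by omega, if_true]
      refine ncard_sq_eq (hk ▸ Finite.one_lt_card) hK hodd h2 ?_
      rw [neg_div, hneg]
      rw [one_div, inv_pow, hpow s (by omega) α hα, inv_one]
  rw [e, ncard_relationTuples_succ (c := q - 1), hcount t le_rfl, Nat.add_sub_cancel]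
  intro α hα
  simp only [hr, lt_irrefl, if_false]
  exact ncard_pow_sub_one_eq hk hK (hneg _ (hpow t le_rfl α hα))

end Quadratic

/-! ### The tower and its degrees -/

theorem mem_nonunits_comap_iff {F L : Type*} [Field F] [Field L] {O : ValuationSubring L}
    {φ : F →+* L} {f : F} : f ∈ (O.comap φ).nonunits ↔ φ f ∈ O.nonunits := by
  rw [ValuationSubring.mem_nonunits_iff_or, ValuationSubring.mem_nonunits_iff_or,
    ValuationSubring.mem_comap, map_inv₀, map_eq_zero]

/-- A valuation ring extends to an overfield. -/
theorem exists_valuationSubring_extension {F L : Type*} [Field F] [Field L]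
    (O : ValuationSubring F) (φ : F →+* L) :
    ∃ A : ValuationSubring L, (∀ f ∈ O, φ f ∈ A) ∧ ∀ f ∈ O.nonunits, φ f ∈ A.nonunits := by
  obtain ⟨A, h, hloc⟩ := IsLocalRing.exists_factor_valuationRing (φ.comp O.subtype)
  refine ⟨A, fun f hf => h ⟨f, hf⟩, fun f hf => ?_⟩
  have hf' : ¬ IsUnit (⟨f, O.nonunits_subset hf⟩ : O) := O.coe_mem_nonunits_iff.1 hf
  have : ¬ IsUnit ((φ.comp O.subtype).codRestrict A.toSubring h ⟨f, O.nonunits_subset hf⟩) :=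
    fun hu => hf' (hloc.map_nonunit _ hu)
  exact (A.coe_mem_nonunits_iff (a := ⟨φ f, h ⟨f, O.nonunits_subset hf⟩⟩)).2 this

theorem exists_valuationSubring_zero {K L : Type*} [Field K] [Field L] [Algebra K L] {y : L}
    (hy : Transcendental K y) (c : K) :
    ∃ O : ValuationSubring L, (∀ a : K, algebraMap K L a ∈ O) ∧
      y - algebraMap K L c ∈ O.nonunits := by
  let A := Algebra.adjoin K {y}
  have hmem : y - algebraMap K L c ∈ A.toSubring :=
    sub_mem (Algebra.subset_adjoin rfl) (Subalgebra.algebraMap_mem _ _)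
  obtain ⟨O, hAO, hO⟩ := Ideal.image_subset_nonunits_valuationSubring
    (Ideal.span {(⟨y - algebraMap K L c, hmem⟩ : A.toSubring)}) (by
      rw [Ne, Ideal.span_singleton_eq_top]
      intro hu
      obtain ⟨⟨v, hv⟩, hv'⟩ := hu.exists_right_inv
      have hv' : (y - algebraMap K L c) * v = 1 := congrArg Subtype.val hv'
      have hv : v ∈ Algebra.adjoin K {y} := hv
      rw [Algebra.adjoin_singleton_eq_range_aeval] at hv
      obtain ⟨p, rfl⟩ := hv
      have h0 : Polynomial.aeval y ((Polynomial.X - Polynomial.C c) * p - 1) = 0 := by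
        simpa [sub_eq_zero] using hv'
      have h1 := (transcendental_iff.1 hy) _ h0
      have h2 := congrArg (Polynomial.eval c) h1
      simp at h2)
  exact ⟨O, fun a => hAO (Subalgebra.algebraMap_mem A a),
    hO ⟨_, Ideal.subset_span rfl, rfl⟩⟩

/-- The elements of `K(T)` are fractions of elements of `K[S]` if `K[S]` contains `T`. -/
theorem exists_fraction_of_adjoin {K L : Type*} [Field K] [Field L] [Algebra K L] {T : Set L}
    {S : Set (IntermediateField.adjoin K T)}
    (h : ∀ x ∈ T, ∃ s ∈ Algebra.adjoin K S, (s : L) = x) (f : IntermediateField.adjoin K T) :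
    ∃ r ∈ Algebra.adjoin K S, ∃ s ∈ Algebra.adjoin K S, f = r / s := by
  have hle : Algebra.adjoin K T ≤ (Algebra.adjoin K S).map (IntermediateField.adjoin K T).val :=
    Algebra.adjoin_le fun x hx => by
      obtain ⟨s, hs, e⟩ := h x hx
      exact ⟨s, hs, e⟩
  obtain ⟨r, hr, s, hs, e⟩ := IntermediateField.mem_adjoin_iff_div.1 f.2
  obtain ⟨r', hr', rfl⟩ := hle hr
  obtain ⟨s', hs', rfl⟩ := hle hs
  exact ⟨r', hr', s', hs', Subtype.ext e⟩

section Restrict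

variable {K L : Type*} [Field K] [Field L] [Algebra K L]

open Classical in
/-- A sequence of elements of `L`, as a sequence of elements of a subfield `E`; the terms outside
`E` are replaced by `0`. -/
noncomputable def restrictSeq (E : IntermediateField K L) (w : ℕ → L) (i : ℕ) : E :=
  if h : w i ∈ E then ⟨w i, h⟩ else 0

theorem coe_restrictSeq {E : IntermediateField K L} {w : ℕ → L} {i : ℕ} (h : w i ∈ E) :
    (restrictSeq E w i : L) = w i := by
  rw [restrictSeq, dif_pos h]

theorem IsBranch.restrict {E : IntermediateField K L} {q N : ℕ} {w : ℕ → L} (hw : IsBranch q N w)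
    (h : ∀ i ≤ N, w i ∈ E) : IsBranch q N (restrictSeq E w) := by
  intro i hi
  apply Subtype.ext
  push_cast
  rw [coe_restrictSeq (h i hi.le), coe_restrictSeq (h (i + 1) hi)]
  exact hw i hi

theorem IsBranchPair.restrict {E : IntermediateField K L} {q N : ℕ} {y z : ℕ → L}
    (h : IsBranchPair q N y z) (hy : ∀ i ≤ N, y i ∈ E) (hz : ∀ i ≤ N, z i ∈ E) :
    IsBranchPair q N (restrictSeq E y) (restrictSeq E z) where
  left := h.left.restrict hz
  right := h.right.restrict hy
  zero := by
    apply Subtype.ext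
    push_cast
    rw [coe_restrictSeq (hy 0 (by omega)), coe_restrictSeq (hz 0 (by omega))]
    exact h.zero
  left_ne_zero i hi h0 := h.left_ne_zero i hi (by
    rw [← coe_restrictSeq (hz i hi), h0]; rfl)
  right_ne_zero i hi h0 := h.right_ne_zero i hi (by
    rw [← coe_restrictSeq (hy i hi), h0]; rfl)

end Restrict

theorem IsKummerTower.transcendental_apply {K L : Type*} [Field K] [Field L] [Algebra K L] {q : ℕ}
    {x : ℕ → L} (hx : IsKummerTower q K x) (hq : 1 < q) (i : ℕ) : Transcendental K (x i) := by
  induction i with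
  | zero => exact hx.transcendental
  | succ i ih =>
    intro h
    apply ih
    have h1 : IsAlgebraic K ((x i + 1) ^ (q - 1)) := by
      rw [← sub_eq_of_eq_add' (hx.equation i).symm]
      exact isAlgebraic_one.sub (h.pow _)
    have h2 := (h1.of_pow (by omega)).sub isAlgebraic_one
    rwa [add_sub_cancel_right] at h2

theorem IsKummerTower.ne_algebraMap {K L : Type*} [Field K] [Field L] [Algebra K L] {q : ℕ}
    {x : ℕ → L} (hx : IsKummerTower q K x) (hq : 1 < q) (i : ℕ) (c : K) :
    x i ≠ algebraMap K L c := fun h =>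
  hx.transcendental_apply hq i (h ▸ isAlgebraic_algebraMap c)

theorem IsKummerTower.isBranch_right {k K L : Type*} [Field k] [Finite k] [Field K] [Field L]
    [Algebra k L] [Algebra K L] {x : ℕ → L} (hx : IsKummerTower (Nat.card k) K x) (m N : ℕ) :
    IsBranch (Nat.card k) N (fun i => x (m + i)) := by
  intro i _
  have hq : 1 < Nat.card k := Finite.one_lt_card
  have h := hx.equation (m + i)
  have h1 := sub_pow_card (k := k) (x (m + i) + 1) 1
  rw [one_pow, add_sub_cancel_right] at h1
  have h2 := mul_pow_sub_one (by omega : Nat.card k ≠ 0) (x (m + i) + 1)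
  rw [h1]
  linear_combination (1 + x (m + i)) * h - h2

theorem IsKummerTower.isBranch_left {k K L : Type*} [Field k] [Finite k] [Field K] [Field L]
    [Algebra k L] [Algebra K L] {x : ℕ → L} (hx : IsKummerTower (Nat.card k) K x)
    (hodd : Odd (Nat.card k)) {m N : ℕ} (hN : N ≤ m) :
    IsBranch (Nat.card k) N (fun i => -(x (m - i) + 1)) := by
  intro i hi
  have hq : 1 < Nat.card k := Finite.one_lt_card
  have h := hx.equation (m - (i + 1))
  rw [show m - (i + 1) + 1 = m - i by omega] at h
  have h1 := sub_pow_card (k := k) (-1) (x (m - i))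
  have h2 := mul_pow_sub_one (by omega : Nat.card k ≠ 0) (x (m - i))
  rw [hodd.neg_one_pow] at h1
  simp only
  rw [(Nat.Odd.sub_odd hodd odd_one).neg_pow,
    show -(x (m - i) + 1) = -1 - x (m - i) by ring, h1]
  linear_combination -x (m - i) * h + h2

theorem IsKummerTower.isBranchPair {k K L : Type*} [Field k] [Finite k] [Field K] [Field L]
    [Algebra k L] [Algebra K L] {x : ℕ → L} (hx : IsKummerTower (Nat.card k) K x)
    (hodd : Odd (Nat.card k)) {m N : ℕ} (hN : N ≤ m) :
    IsBranchPair (Nat.card k) N (fun i => x (m + i)) (fun i => -(x (m - i) + 1)) where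
  left := hx.isBranch_left hodd hN
  right := hx.isBranch_right m N
  zero := by simp [add_comm]
  left_ne_zero i _ h := hx.ne_algebraMap Finite.one_lt_card (m - i) (-1) (by
    rw [map_neg, map_one]; linear_combination -h)
  right_ne_zero i _ h := hx.ne_algebraMap Finite.one_lt_card (m + i) 0 (by rw [map_zero, h])

theorem mem_windowField {K L : Type*} [Field K] [Field L] [Algebra K L] {x : ℕ → L}
    {a b i : ℕ} (ha : a ≤ i) (hb : i ≤ b) : x i ∈ windowField K x a b :=
  IntermediateField.subset_adjoin K _ ⟨i, ⟨ha, hb⟩, rfl⟩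

theorem neg_add_one_mem_windowField {K L : Type*} [Field K] [Field L] [Algebra K L] {x : ℕ → L}
    {a b i : ℕ} (ha : a ≤ i) (hb : i ≤ b) :
    -(x i + 1) ∈ windowField K x a b :=
  neg_mem (add_mem (mem_windowField ha hb) (one_mem _))

section Tower

variable {k K L : Type*} [Field k] [Finite k] [Field K] [Field L] [Algebra k K] [Algebra k L]
  [Algebra K L] [IsScalarTower k K L] {x : ℕ → L}

/-- Going down the tower, each step has full degree `q - 1`, because it is totally ramified over
`x_b = 1`. -/
theorem IsKummerTower.irreducible (hx : IsKummerTower (Nat.card k) K x) (hodd : Odd (Nat.card k))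
    {b N : ℕ} (hN : N + 1 ≤ b) {c : windowField K x (b - N) b}
    (hc : (c : L) = 1 - x (b - N) ^ (Nat.card k - 1)) :
    Irreducible (Polynomial.X ^ (Nat.card k - 1) - Polynomial.C c) := by
  have hq : 1 < Nat.card k := Finite.one_lt_card
  set E := windowField K x (b - N) b
  have : IsScalarTower k E L := .of_algebraMap_eq fun _ => rfl
  obtain ⟨O, hKO, hO⟩ := exists_valuationSubring_zero (hx.transcendental_apply hq b) (1 : K)
  set w : ℕ → L := fun i => -(x (b - i) + 1) with hw
  have hmem : ∀ i ≤ N, w i ∈ E := fun i hi =>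
    neg_add_one_mem_windowField (by omega) (by omega)
  have hb := (hx.isBranch_left hodd (show N ≤ b by omega)).restrict hmem
  have hwc : ∀ i ≤ N, (restrictSeq E w i : L) = w i := fun i hi => coe_restrictSeq (hmem i hi)
  refine hb.irreducible (K := K) (β := -2) (O := O.comap (algebraMap E L)) ?_ ?_ ?_ ?_ ?_ ?_
  · intro a
    rw [ValuationSubring.mem_comap, ← IsScalarTower.algebraMap_apply]
    exact hKO a
  · intro h
    exact one_ne_zero (α := k) (by linear_combination -h)
  · rw [mem_nonunits_comap_iff, map_sub, ← IsScalarTower.algebraMap_apply]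
    have e : algebraMap E L (restrictSeq E w 0) - algebraMap k L (-2) =
        -(x b - algebraMap K L 1) := by
      change (restrictSeq E w 0 : L) - _ = _
      rw [hwc 0 (by omega), map_neg, map_ofNat, map_one]
      simp only [hw, Nat.sub_zero]
      ring
    rw [e]
    exact neg_mem hO
  · refine exists_fraction_of_adjoin ?_
    rintro _ ⟨i, hi, rfl⟩
    have hi1 := hi.1
    have hi2 := hi.2
    refine ⟨-restrictSeq E w (b - i) - 1, sub_mem (neg_mem (Algebra.subset_adjoin
      ⟨b - i, by simp only [Set.mem_Iic]; omega, rfl⟩)) (one_mem _), ?_⟩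
    push_cast
    rw [hwc _ (by omega)]
    simp only [hw, show b - (b - i) = i by omega]
    ring
  · intro h
    have hne : ∀ a : k, w N ≠ algebraMap k L a := by
      intro a ha
      refine hx.ne_algebraMap hq (b - N) (algebraMap k K (-1 - a)) ?_
      rw [← IsScalarTower.algebraMap_apply, map_sub, ← ha, map_neg, map_one]
      simp only [hw]
      ring
    have hE : ∀ a : k, restrictSeq E w N ≠ algebraMap k E a := fun a ha => hne a (by
      rw [← hwc N le_rfl, ha]; rfl)
    cases N with
    | zero => exact hE _ (sub_eq_zero.1 h)
    | succ N => exact hE 0 (by rw [map_zero]; exact h)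
  · apply Subtype.ext
    push_cast
    rw [hwc N le_rfl, hc]
    have hb' := hx.isBranch_left hodd hN N (Nat.lt_succ_self N)
    have heq := hx.equation (b - (N + 1))
    rw [show b - (N + 1) + 1 = b - N by omega] at heq
    simp only [(Nat.Odd.sub_odd hodd odd_one).neg_pow] at hb'
    rw [← hb']
    simp only [hw]
    linear_combination x (b - N) * heq

end Tower

/-! ### Existence of central places -/

section Existence

variable {k K L : Type*} [Field k] [Finite k] [Field K] [Field L] [Algebra k K] [Algebra k L]
  [Algebra K L] [IsScalarTower k K L] {x : ℕ → L}

/-- The next ratio at a central place: `u_{s+1} ^ (q - 1) ≡ -α_s`. -/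
theorem IsBranchPair.ratio_pow_congr {F : Type*} [Field F] [Algebra k F] [Algebra K F]
    [IsScalarTower k K F] {y z : ℕ → F} {s N : ℕ} {O : ValuationSubring F} {α : ℕ → K}
    (h : IsBranchPair (Nat.card k) N y z) (hodd : Odd (Nat.card k)) (h2 : (2 : k) ≠ 0)
    (hα0 : α 0 = 1) (hs : s < N) (hO : IsCentralAt O s y z α) :
    (y (s + 1) / -z (s + 1)) ^ (Nat.card k - 1) + algebraMap K F (α s) ∈ O.nonunits := by
  have hk := algebraMap_mem_of_tower (k := k) hO.algebraMap_mem
  have h0 := hO.zero_of_tower (k := k)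
  rcases Nat.eq_zero_or_pos s with rfl | hs'
  · have := h.ratio_one_congr hodd (by omega) hk (neg_half_ne_neg_one h2) h0
    have e : (-1 / 2 : k) / (1 + -1 / 2) = -1 := by
      have : (1 + -1 / 2 : k) = 1 / 2 := by field_simp; ring
      rw [this]
      field_simp
    rw [e, map_neg, map_one, sub_neg_eq_add] at this
    rw [hα0, map_one]
    exact this
  · exact h.ratio_succ_congr hodd hk (neg_half_ne_zero h2) (neg_half_ne_neg_one h2) h0 hs' hs
      (hO.algebraMap_mem _) (hO.ratio s hs' le_rfl)

/-- If `u ^ (q - 1) ≡ a ^ (q - 1)` for a nonzero constant `a`, then `u ≡ ζ a` with `ζ ∈ k`,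
`ζ ≠ 0`. -/
theorem exists_congr_mul_of_pow_congr {F : Type*} [Field F] [Algebra k F] [Algebra K F]
    [IsScalarTower k K F] {O : ValuationSubring F} (hK : ∀ c : K, algebraMap K F c ∈ O) {u : F}
    {a : K} (ha : a ≠ 0)
    (h : u ^ (Nat.card k - 1) - algebraMap K F a ^ (Nat.card k - 1) ∈ O.nonunits) :
    ∃ ζ : k, ζ ≠ 0 ∧ u - algebraMap k F ζ * algebraMap K F a ∈ O.nonunits := by
  have hq : 1 < Nat.card k := Finite.one_lt_card
  have ha' : algebraMap K F a ≠ 0 := (map_ne_zero _).2 ha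
  have hinv : ∀ n : ℕ, ((algebraMap K F a) ^ n)⁻¹ ∈ O := fun n => by
    rw [← map_pow, ← map_inv₀]; exact hK _
  have h1 : (u / algebraMap K F a) ^ (Nat.card k - 1) - 1 ∈ O.nonunits := by
    have e : (u / algebraMap K F a) ^ (Nat.card k - 1) - 1 =
        (algebraMap K F a ^ (Nat.card k - 1))⁻¹ *
          (u ^ (Nat.card k - 1) - algebraMap K F a ^ (Nat.card k - 1)) := by
      rw [div_pow]; field_simp
    rw [e]
    exact mul_mem_nonunits (hinv _) h
  have hr : u / algebraMap K F a ∈ O :=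
    mem_of_pow_mem (n := Nat.card k - 1) (by omega) (mem_of_sub_mem_nonunits O.one_mem h1)
  obtain ⟨ζ, hζ⟩ := exists_congr_of_pow_card_congr (k := k) (O := O) (u / algebraMap K F a) (by
    have e : (u / algebraMap K F a) ^ Nat.card k - u / algebraMap K F a =
        u / algebraMap K F a * ((u / algebraMap K F a) ^ (Nat.card k - 1) - 1) := by
      rw [mul_sub, mul_one, mul_pow_sub_one (by omega)]
    rw [e]
    exact mul_mem_nonunits hr h1)
  refine ⟨ζ, ?_, ?_⟩
  · rintro rfl
    rw [map_zero, sub_zero] at hζ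
    refine one_sub_pow_notMem_nonunits (n := Nat.card k - 1) (by omega) hζ ?_
    rw [← neg_sub]
    exact neg_mem h1
  · have e : u - algebraMap k F ζ * algebraMap K F a =
        algebraMap K F a * (u / algebraMap K F a - algebraMap k F ζ) := by field_simp
    rw [e]
    exact mul_mem_nonunits (hK _) hζ

/-- At a central valuation ring the next ratio `u_{s+1}` has the value `ζ α_{s+1}` for some nonzero
`ζ ∈ k`. Since the step from `x_{m-s}` to `x_{m-s-1}` has full degree, there is a homomorphism over
`K(x_{m-s}, …, x_{m+s+1})` that multiplies `x_{m-s-1} + 1` by `ζ`; pulling back along it moves the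
value to `α_{s+1}`. -/
theorem IsKummerTower.exists_isCentralAt_succ (hx : IsKummerTower (Nat.card k) K x)
    (hodd : Odd (Nat.card k)) (h2 : (2 : k) ≠ 0) {m s : ℕ} (hs : s + 1 ≤ m) {α : ℕ → K}
    (hα : IsResidueChain (Nat.card k) (s + 1) α) {O : ValuationSubring L}
    (hO : IsCentralAt O s (fun i => x (m + i)) (fun i => -(x (m - i) + 1)) α) :
    ∃ A : ValuationSubring L,
      IsCentralAt A (s + 1) (fun i => x (m + i)) (fun i => -(x (m - i) + 1)) α := by
  have hq : 1 < Nat.card k := Finite.one_lt_card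
  have hpair := hx.isBranchPair hodd hs
  have hratio := hpair.ratio_pow_congr hodd h2 hα.zero (Nat.lt_succ_self s) hO
  obtain ⟨ζ, hζ0, hζ⟩ := exists_congr_mul_of_pow_congr (k := k) hO.algebraMap_mem
    (u := x (m + (s + 1)) / -(-(x (m - (s + 1)) + 1))) (hα.ne_zero hq (s + 1) le_rfl) (by
      rw [← map_pow, hα.succ s (Nat.lt_succ_self s), map_neg, sub_neg_eq_add]
      exact hratio)
  set E := windowField K x (m + (s + 1) - (2 * s + 1)) (m + (s + 1)) with hE
  have hlow : m + (s + 1) - (2 * s + 1) = m - s := by omega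
  have hmem : ∀ i, m - s ≤ i → i ≤ m + (s + 1) → x i ∈ E := fun i h1 h2 =>
    mem_windowField (by omega) h2
  set z' : L := -(x (m - (s + 1)) + 1) with hz'
  set c : E := 1 - ⟨x (m - s), hmem _ le_rfl (by omega)⟩ ^ (Nat.card k - 1) with hc
  have hcL : (c : L) = 1 - x (m - s) ^ (Nat.card k - 1) := rfl
  have hzc : z' ^ (Nat.card k - 1) = c := by
    have heq := hx.equation (m - (s + 1))
    rw [show m - (s + 1) + 1 = m - s by omega] at heq
    rw [hcL, hz', (Nat.Odd.sub_odd hodd odd_one).neg_pow]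
    linear_combination heq
  have hirr := hx.irreducible hodd (b := m + (s + 1)) (N := 2 * s + 1) (by omega) (c := c)
    (by rw [hcL, hlow])
  have hmin : minpoly E z' = Polynomial.X ^ (Nat.card k - 1) - Polynomial.C c := by
    refine (minpoly.eq_of_irreducible_of_monic hirr ?_ (Polynomial.monic_X_pow_sub_C _ ?_)).symm
    · simp only [map_sub, map_pow, Polynomial.aeval_X, Polynomial.aeval_C]
      rw [hzc]
      exact sub_self _
    · omega
  have hint : IsIntegral E z' := by
    refine ⟨_, Polynomial.monic_X_pow_sub_C c (n := Nat.card k - 1) (by omega), ?_⟩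
    rw [← Polynomial.aeval_def]
    simp only [map_sub, map_pow, Polynomial.aeval_X, Polynomial.aeval_C]
    rw [hzc]
    exact sub_self _
  have hζ1 : algebraMap k L ζ ^ (Nat.card k - 1) = 1 := by
    cases nonempty_fintype k
    rw [← map_pow, Nat.card_eq_fintype_card, FiniteField.pow_card_sub_one_eq_one ζ hζ0, map_one]
  have hroot : algebraMap k L ζ * z' ∈ (minpoly E z').aroots L := by
    rw [hmin, Polynomial.mem_aroots]
    refine ⟨hirr.ne_zero, ?_⟩
    simp only [map_sub, map_pow, Polynomial.aeval_X, Polynomial.aeval_C]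
    rw [mul_pow, hζ1, one_mul, hzc]
    exact sub_self _
  let τ := (IntermediateField.algHomAdjoinIntegralEquiv E hint).symm ⟨_, hroot⟩
  have hτ : τ (IntermediateField.AdjoinSimple.gen E z') = algebraMap k L ζ * z' :=
    IntermediateField.algHomAdjoinIntegralEquiv_symm_apply_gen E hint ⟨_, hroot⟩
  obtain ⟨A, hA, hA'⟩ := exists_valuationSubring_extension
    (O.comap (τ : IntermediateField.adjoin E {z'} →+* L))
    (algebraMap (IntermediateField.adjoin E {z'}) L)
  -- The homomorphism `τ` fixes `E`, so congruences between elements of `E` are preserved.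
  have key : ∀ f ∈ E, f ∈ O.nonunits → f ∈ A.nonunits := by
    intro f hf hfO
    refine hA' (algebraMap E (IntermediateField.adjoin E {z'}) ⟨f, hf⟩) ?_
    rw [mem_nonunits_comap_iff]
    change τ _ ∈ _
    rw [τ.commutes]
    exact hfO
  have hEK : ∀ a : K, algebraMap K L a ∈ E := fun a => E.algebraMap_mem a
  refine ⟨A, fun a => ?_, ?_, fun i hi his => ?_⟩
  · refine hA (algebraMap E (IntermediateField.adjoin E {z'}) (algebraMap K E a)) ?_
    rw [ValuationSubring.mem_comap]
    change τ _ ∈ _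
    rw [τ.commutes]
    exact hO.algebraMap_mem a
  · exact key _ (sub_mem (hmem _ (by omega) (by omega)) (hEK _)) hO.zero
  · rcases his.eq_or_lt with rfl | his
    · let y' : E := ⟨x (m + (s + 1)), hmem _ (by omega) le_rfl⟩
      let g : IntermediateField.adjoin E {z'} := algebraMap E _ y' /
        -IntermediateField.AdjoinSimple.gen E z' - algebraMap E _ (algebraMap K E (α (s + 1)))
      have hg : g ∈ (O.comap (τ : IntermediateField.adjoin E {z'} →+* L)).nonunits := by
        rw [mem_nonunits_comap_iff]
        change τ g ∈ _
        have hζL : algebraMap k L ζ ≠ 0 := (map_ne_zero _).2 hζ0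
        have e : τ g = algebraMap k L ζ⁻¹ * (x (m + (s + 1)) / -z' -
            algebraMap k L ζ * algebraMap K L (α (s + 1))) := by
          simp only [g, map_sub, map_div₀, map_neg, hτ, AlgHom.commutes]
          change x (m + (s + 1)) / -(algebraMap k L ζ * z') - algebraMap K L (α (s + 1)) = _
          rw [map_inv₀]
          have hz0 : z' ≠ 0 := hpair.left_ne_zero (s + 1) le_rfl
          field_simp
        rw [e]
        exact mul_mem_nonunits (algebraMap_mem_of_tower hO.algebraMap_mem _) hζ
      exact hA' g hg
    · refine key _ (sub_mem (div_mem (hmem _ (by omega) (by omega)) (neg_mem (neg_mem (add_mem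
        (hmem _ (by omega) (by omega)) (one_mem _))))) (hEK _)) (hO.ratio i hi (by omega))

theorem IsKummerTower.exists_isCentralAt (hx : IsKummerTower (Nat.card k) K x)
    (hodd : Odd (Nat.card k)) (h2 : (2 : k) ≠ 0) {m t : ℕ} (ht : t ≤ m) {α : ℕ → K}
    (hα : IsResidueChain (Nat.card k) t α) :
    ∃ O : ValuationSubring L,
      IsCentralAt O t (fun i => x (m + i)) (fun i => -(x (m - i) + 1)) α := by
  induction t with
  | zero =>
    obtain ⟨O, hK, hO⟩ := exists_valuationSubring_zero
      (hx.transcendental_apply Finite.one_lt_card m) (-1 / 2 : K)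
    exact ⟨O, hK, hO, fun i hi hi' => absurd hi (by omega)⟩
  | succ s ih =>
    obtain ⟨O, hO⟩ := ih (by omega) ⟨hα.zero, fun i hi => hα.succ i (by omega)⟩
    exact hx.exists_isCentralAt_succ hodd h2 ht hα hO

end Existence

/-! ### Places of the window field -/

theorem Place.isRational_iff {K F : Type*} [Field K] [Field F] [Algebra K F] {P : Place K F} :
    P.IsRational ↔ ∀ f ∈ P.ring, ∃ c : K, P.Congr f c := by
  have h : ∀ (c : K) (f : P.ring), c • (1 : IsLocalRing.ResidueField P.ring) =
      IsLocalRing.residue P.ring f ↔ P.Congr f c := by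
    intro c f
    have h1 : c • (1 : IsLocalRing.ResidueField P.ring) =
        IsLocalRing.residue P.ring ⟨algebraMap K F c, P.algebraMap_mem c⟩ := by
      rw [Algebra.smul_def, mul_one]
      rfl
    rw [h1, eq_comm, ← sub_eq_zero, ← map_sub, IsLocalRing.residue_eq_zero_iff,
      ← P.ring.coe_mem_nonunits_iff]
    rfl
  rw [Place.IsRational, Place.degree, finrank_eq_one_iff_of_nonzero' 1 one_ne_zero]
  constructor
  · intro H f hf
    obtain ⟨c, hc⟩ := H (IsLocalRing.residue P.ring ⟨f, hf⟩)
    exact ⟨c, (h c ⟨f, hf⟩).1 hc⟩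
  · intro H w
    obtain ⟨f, rfl⟩ := IsLocalRing.residue_surjective w
    obtain ⟨c, hc⟩ := H f f.2
    exact ⟨c, (h c f).2 hc⟩

theorem Place.ext_ring {K F : Type*} [Field K] [Field F] [Algebra K F] {P Q : Place K F}
    (h : P.ring = Q.ring) : P = Q := by
  cases P
  cases Q
  cases h
  rfl

theorem const_eq_of_congr {K F : Type*} [Field K] [Field F] [Algebra K F] {O : ValuationSubring F}
    (hK : ∀ c : K, algebraMap K F c ∈ O) {f : F} {a b : K} (ha : f - algebraMap K F a ∈ O.nonunits)
    (hb : f - algebraMap K F b ∈ O.nonunits) : a = b := by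
  by_contra h
  refine algebraMap_notMem_nonunits hK (sub_ne_zero.2 h) ?_
  have := sub_mem hb ha
  rwa [sub_sub_sub_cancel_left, ← map_sub] at this

theorem pow_congr {F : Type*} [Field F] {O : ValuationSubring F} {f g : F} (hf : f ∈ O)
    (hg : g ∈ O) (h : f - g ∈ O.nonunits) (n : ℕ) : f ^ n - g ^ n ∈ O.nonunits := by
  obtain ⟨c, hc⟩ := sub_dvd_pow_sub_pow (⟨f, hf⟩ : O) ⟨g, hg⟩ n
  have hc : f ^ n - g ^ n = (f - g) * c := congrArg Subtype.val hc
  rw [hc, mul_comm]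
  exact mul_mem_nonunits c.2 h

section Central

variable {k K F : Type*} [Field k] [Finite k] [Field K] [Field F] [Algebra k K] [Algebra k F]
  [Algebra K F] [IsScalarTower k K F] {y z : ℕ → F} {N : ℕ} {O : ValuationSubring F}

/-- If `β / (1 + β) ∈ k` is a `(q - 1)`-st power in `K`, its square, which is its `(q + 1)`-st
power, is `1`; the value `1` is impossible and `-1` gives `β = -1/2`. -/
theorem eq_neg_half_of_pow_eq {q : ℕ} (hk : Nat.card k = q) (hK : Nat.card K = q ^ 2)
    (h2 : (2 : k) ≠ 0) {β : k} (hβ0 : β ≠ 0) (hβ1 : β ≠ -1) {a : K}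
    (h : a ^ (q - 1) = algebraMap k K (β / (1 + β))) : β = -1 / 2 := by
  have hq : 1 < q := hk ▸ Finite.one_lt_card
  have hβ : 1 + β ≠ 0 := fun h => hβ1 (by linear_combination h)
  have ha : a ≠ 0 := by
    rintro rfl
    rw [zero_pow (by omega), eq_comm, map_eq_zero] at h
    exact div_ne_zero hβ0 hβ h
  have h1 := pow_sub_one_mul_add_one hq hK ha
  cases nonempty_fintype k
  have h3 : (β / (1 + β)) ^ (q + 1) = (β / (1 + β)) ^ 2 := by
    rw [pow_succ, ← hk, Nat.card_eq_fintype_card, FiniteField.pow_card, sq]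
  rw [h, ← map_pow, h3, ← map_one (algebraMap k K)] at h1
  have h4 := (algebraMap k K).injective h1
  rcases sq_eq_sq_iff_eq_or_eq_neg.1 (h4.trans (one_pow 2).symm) with h5 | h5
  · rw [div_eq_iff hβ] at h5
    exact absurd (by linear_combination -h5) (one_ne_zero (α := k))
  · rw [div_eq_iff hβ] at h5
    rw [eq_div_iff h2]
    linear_combination h5

/-- At a `K`-rational place over `y_0 = β` the ratios have values in `K`; this forces `β = -1/2`. -/
theorem IsBranchPair.exists_isCentralAt_of_rational (h : IsBranchPair (Nat.card k) N y z)
    (hodd : Odd (Nat.card k)) (h2 : (2 : k) ≠ 0) (hN : 1 ≤ N) (hKq : Nat.card K = Nat.card k ^ 2)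
    (hK : ∀ c : K, algebraMap K F c ∈ O)
    (hrat : ∀ f ∈ O, ∃ c : K, f - algebraMap K F c ∈ O.nonunits) {β : k} (hβ0 : β ≠ 0)
    (hβ1 : β ≠ -1) (h0 : y 0 - algebraMap k F β ∈ O.nonunits) :
    ∃ α : ℕ → K, IsResidueChain (Nat.card k) N α ∧ IsCentralAt O N y z α := by
  have hq : 1 < Nat.card k := Finite.one_lt_card
  have hk := algebraMap_mem_of_tower (k := k) hK
  have hpow : ∀ f g : F, g ∈ O → f ^ (Nat.card k - 1) - g ∈ O.nonunits → f ∈ O := fun f g hg hf =>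
    mem_of_pow_mem (n := Nat.card k - 1) (by omega) (mem_of_sub_mem_nonunits hg hf)
  have hex : ∀ i, 1 ≤ i → i ≤ N → ∃ c : K, y i / -z i - algebraMap K F c ∈ O.nonunits := by
    intro i hi hiN
    induction i, hi using Nat.le_induction with
    | base => exact hrat _ (hpow _ _ (hk _) (h.ratio_one_congr hodd hN hk hβ1 h0))
    | succ i hi ih =>
      obtain ⟨c, hc⟩ := ih (by omega)
      refine hrat _ (hpow _ (-algebraMap K F c) (neg_mem (hK c)) ?_)
      rw [sub_neg_eq_add]
      exact h.ratio_succ_congr hodd hk hβ0 hβ1 h0 hi (by omega) (hK _) hc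
  choose! a ha using hex
  have hconst : ∀ i, 1 ≤ i → i ≤ N → ∀ c : K,
      (y i / -z i) ^ (Nat.card k - 1) - algebraMap K F c ∈ O.nonunits →
        a i ^ (Nat.card k - 1) = c := by
    intro i hi hiN c hc
    refine const_eq_of_congr hK ?_ hc
    rw [map_pow]
    exact pow_congr (mem_of_sub_mem_nonunits (hK _) (ha i hi hiN)) (hK _) (ha i hi hiN) _
  have h1 : a 1 ^ (Nat.card k - 1) = algebraMap k K (β / (1 + β)) := by
    refine hconst 1 le_rfl hN _ ?_
    rw [← IsScalarTower.algebraMap_apply]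
    exact h.ratio_one_congr hodd hN hk hβ1 h0
  obtain rfl := eq_neg_half_of_pow_eq rfl hKq h2 hβ0 hβ1 h1
  have hO : ∀ s ≤ N, IsCentralAt O s y z (Function.update a 0 1) := fun s hs =>
    ⟨hK, by rw [algebraMap_neg_half k K F]; exact h0, fun i hi hi' => by
      rw [Function.update_of_ne (by omega)]
      exact ha i hi (by omega)⟩
  refine ⟨Function.update a 0 1, ⟨Function.update_self .., fun i hi => ?_⟩, hO N le_rfl⟩
  rw [Function.update_of_ne (by omega)]
  refine hconst (i + 1) (by omega) hi _ ?_
  rw [map_neg, sub_neg_eq_add]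
  exact h.ratio_pow_congr hodd h2 (Function.update_self ..) hi (hO i hi.le)

end Central

section Window

variable {k K L : Type*} [Field k] [Finite k] [Field K] [Field L] [Algebra k K] [Algebra k L]
  [Algebra K L] [IsScalarTower k K L] {x : ℕ → L} {m t : ℕ}

/-- The functions `x_m, x_{m+1}, …` in `K(x_{m-t}, …, x_{m+t})`. -/
noncomputable abbrev windowRight (K : Type*) {L : Type*} [Field K] [Field L] [Algebra K L]
    (x : ℕ → L) (m t : ℕ) : ℕ → windowField K x (m - t) (m + t) :=
  restrictSeq (windowField K x (m - t) (m + t)) (fun i => x (m + i))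

/-- The functions `-(x_m + 1), -(x_{m-1} + 1), …` in `K(x_{m-t}, …, x_{m+t})`. -/
noncomputable abbrev windowLeft (K : Type*) {L : Type*} [Field K] [Field L] [Algebra K L]
    (x : ℕ → L) (m t : ℕ) : ℕ → windowField K x (m - t) (m + t) :=
  restrictSeq (windowField K x (m - t) (m + t)) (fun i => -(x (m - i) + 1))

theorem windowGen_add {K L : Type*} [Field K] [Field L] [Algebra K L] {x : ℕ → L} {m t i : ℕ}
    (h : m - t ≤ m + i ∧ m + i ≤ m + t) :
    windowGen K x (m - t) (m + t) (m + i) h = windowRight K x m t i :=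
  Subtype.ext (coe_restrictSeq (E := windowField K x (m - t) (m + t)) (w := fun i => x (m + i))
    (mem_windowField (by omega) (by omega))).symm

theorem windowGen_sub_add_one {K L : Type*} [Field K] [Field L] [Algebra K L] {x : ℕ → L}
    {m t i : ℕ} (h : m - t ≤ m - i ∧ m - i ≤ m + t) :
    windowGen K x (m - t) (m + t) (m - i) h + 1 = -windowLeft K x m t i := by
  apply Subtype.ext
  push_cast
  rw [coe_restrictSeq (w := fun i => -(x (m - i) + 1))
    (neg_add_one_mem_windowField (by omega) (by omega)), neg_neg]
  rfl

theorem exists_windowField_fraction {K L : Type*} [Field K] [Field L] [Algebra K L] {x : ℕ → L}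
    {m t : ℕ} (ht : t ≤ m) (f : windowField K x (m - t) (m + t)) :
    ∃ r ∈ Algebra.adjoin K (pairGenerators t (windowRight K x m t) (windowLeft K x m t)),
      ∃ s ∈ Algebra.adjoin K (pairGenerators t (windowRight K x m t) (windowLeft K x m t)),
        f = r / s := by
  refine exists_fraction_of_adjoin ?_ f
  rintro _ ⟨i, ⟨hi1, hi2⟩, rfl⟩
  rcases le_total m i with hi | hi
  · refine ⟨windowRight K x m t (i - m), Algebra.subset_adjoin
      (.inl (.inl ⟨i - m, by simp only [Set.mem_Iic]; omega, rfl⟩)), ?_⟩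
    rw [← windowGen_add (by omega)]
    change x (m + (i - m)) = x i
    rw [Nat.add_sub_cancel' hi]
  · refine ⟨-windowLeft K x m t (m - i) - 1, sub_mem (neg_mem (Algebra.subset_adjoin
      (.inl (.inr ⟨m - i, by simp only [Set.mem_Iic]; omega, rfl⟩)))) (one_mem _), ?_⟩
    rw [← windowGen_sub_add_one (by omega), add_sub_cancel_right]
    change x (m - (m - i)) = x i
    rw [Nat.sub_sub_self hi]

theorem IsKummerTower.isBranchPair_window {k K L : Type*} [Field k] [Finite k] [Field K]
    [Field L] [Algebra k L] [Algebra K L] {x : ℕ → L} {m t : ℕ}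
    (hx : IsKummerTower (Nat.card k) K x)
    (hodd : Odd (Nat.card k)) (ht : t ≤ m) :
    IsBranchPair (Nat.card k) t (windowRight K x m t) (windowLeft K x m t) :=
  (hx.isBranchPair hodd ht).restrict (fun i hi => mem_windowField (by omega) (by omega))
    (fun i hi => neg_add_one_mem_windowField (by omega) (by omega))

theorem exists_isCentralAt_of_mem_centralPlaces (hx : IsKummerTower (Nat.card k) K x)
    (hodd : Odd (Nat.card k)) (h2 : (2 : k) ≠ 0) (hK : Nat.card K = Nat.card k ^ 2) (ht : 1 ≤ t)
    (htm : t ≤ m) {Q : Place K (windowField K x (m - t) (m + t))}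
    (hQ : Q ∈ centralPlaces k K x m t) :
    ∃ α : ℕ → K, IsResidueChain (Nat.card k) t α ∧
      IsCentralAt Q.ring t (windowRight K x m t) (windowLeft K x m t) α := by
  obtain ⟨hrat, -, β, hβ0, hβ1, hβ⟩ := hQ
  refine (hx.isBranchPair_window hodd htm).exists_isCentralAt_of_rational hodd h2 ht hK
    Q.algebraMap_mem (Place.isRational_iff.1 hrat) hβ0 hβ1 ?_
  rw [IsScalarTower.algebraMap_apply k K, ← windowGen_add (i := 0) (by omega)]
  exact hβ

theorem mem_centralPlaces_of_isCentralAt (hx : IsKummerTower (Nat.card k) K x)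
    (hodd : Odd (Nat.card k)) (h2 : (2 : k) ≠ 0) (ht : 1 ≤ t)
    (htm : t ≤ m) {Q : Place K (windowField K x (m - t) (m + t))} {α : ℕ → K}
    (hα : IsResidueChain (Nat.card k) t α)
    (hQ : IsCentralAt Q.ring t (windowRight K x m t) (windowLeft K x m t) α) :
    Q ∈ centralPlaces k K x m t := by
  have hq : 1 < Nat.card k := Finite.one_lt_card
  have hpair := hx.isBranchPair_window hodd htm
  refine ⟨Place.isRational_iff.2 fun f hf => hpair.exists_congr hodd h2 ht hα hQ
    (exists_windowField_fraction htm) hf, ?_, -1 / 2, neg_half_ne_zero h2, neg_half_ne_neg_one h2,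
    ?_⟩
  · rintro ⟨P, hPQ, hP⟩
    -- The value `α_1` of the first ratio does not lie in `k`, because `α_1 ^ (q - 1) = -1`.
    let f : windowField k x (m - t) (m + t) := windowGen k x (m - t) (m + t) (m + 1) (by omega) /
      (windowGen k x (m - t) (m + t) (m - 1) (by omega) + 1)
    have hf : windowInclusion k K x (m - t) (m + t) f =
        windowRight K x m t 1 / -windowLeft K x m t 1 := by
      rw [← windowGen_add (by omega), ← windowGen_sub_add_one (by omega), map_div₀, map_add,
        map_one]
      rfl
    have hfQ := hQ.ratio 1 le_rfl ht
    rw [← hf] at hfQ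
    have hfP : f ∈ P.ring := by
      rw [show P.ring = _ from hPQ, ValuationSubring.mem_comap]
      exact mem_of_sub_mem_nonunits (hQ.algebraMap_mem _) hfQ
    obtain ⟨c, hc⟩ := Place.isRational_iff.1 hP f hfP
    have hc' : f - algebraMap k _ c ∈ P.ring.nonunits := hc
    rw [show P.ring = _ from hPQ, mem_nonunits_comap_iff, map_sub] at hc'
    have e : windowInclusion k K x (m - t) (m + t) (algebraMap k _ c) =
        algebraMap K _ (algebraMap k K c) :=
      Subtype.ext (IsScalarTower.algebraMap_apply k K L c)
    rw [e] at hc'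
    have h1 := const_eq_of_congr hQ.algebraMap_mem hfQ hc'
    have h3 := hα.succ 0 ht
    rw [zero_add, h1, hα.zero, ← map_pow, ← map_one (algebraMap k K), ← map_neg] at h3
    have h4 := (algebraMap k K).injective h3
    cases nonempty_fintype k
    by_cases hc0 : c = 0
    · rw [hc0, zero_pow (by omega)] at h4
      exact one_ne_zero (α := k) (by linear_combination h4)
    · rw [Nat.card_eq_fintype_card, FiniteField.pow_card_sub_one_eq_one c hc0] at h4
      exact h2 (by linear_combination h4)
  · have := hQ.zero
    rw [← windowGen_add (i := 0) (by omega)] at this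
    have e : algebraMap k K (-1 / 2) = -1 / 2 := by
      rw [← algebraMap_neg_half k K K]; rfl
    rw [e]
    exact this

theorem exists_place_isCentralAt (hx : IsKummerTower (Nat.card k) K x)
    (hodd : Odd (Nat.card k)) (h2 : (2 : k) ≠ 0) (ht : 1 ≤ t)
    (htm : t ≤ m) {α : ℕ → K} (hα : IsResidueChain (Nat.card k) t α) :
    ∃ Q : Place K (windowField K x (m - t) (m + t)),
      IsCentralAt Q.ring t (windowRight K x m t) (windowLeft K x m t) α := by
  obtain ⟨O, hO⟩ := hx.exists_isCentralAt hodd h2 htm hα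
  have hpair := hx.isBranchPair_window hodd htm
  set E := windowField K x (m - t) (m + t) with hE
  have hy : ∀ i ≤ t, (windowRight K x m t i : L) = x (m + i) := fun i hi => by
    rw [← windowGen_add (by omega)]; rfl
  have hz : ∀ i ≤ t, (windowLeft K x m t i : L) = -(x (m - i) + 1) := fun i hi => by
    rw [← neg_neg (windowLeft K x m t i), ← windowGen_sub_add_one (by omega)]; rfl
  have hC : IsCentralAt (O.comap (algebraMap E L)) t (windowRight K x m t)
      (windowLeft K x m t) α := by
    refine ⟨fun c => ?_, ?_, fun i hi hit => ?_⟩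
    · rw [ValuationSubring.mem_comap]
      exact hO.algebraMap_mem c
    · rw [mem_nonunits_comap_iff]
      change (windowRight K x m t 0 : L) - algebraMap K L (-1 / 2) ∈ _
      rw [hy 0 (by omega)]
      exact hO.zero
    · rw [mem_nonunits_comap_iff]
      change (windowRight K x m t i : L) / -(windowLeft K x m t i : L) - algebraMap K L (α i) ∈ _
      rw [hy i hit, hz i hit]
      exact hO.ratio i hi hit
  refine ⟨⟨O.comap (algebraMap E L), hC.algebraMap_mem, fun htop => ?_⟩, hC⟩
  have h1 := (hpair.mem_nonunits (algebraMap_mem_of_tower (k := k) hC.algebraMap_mem)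
    (neg_half_ne_zero h2) (neg_half_ne_neg_one h2) hC.zero_of_tower ht le_rfl).1
  rw [htop, ValuationSubring.mem_nonunits_iff_or] at h1
  exact h1.elim (hpair.right_ne_zero t le_rfl) fun h => h (ValuationSubring.mem_top _)

end Window

theorem IsCentralAt.congr_chain {K F : Type*} [Field K] [Field F] [Algebra K F]
    {O : ValuationSubring F} {N : ℕ} {y z : ℕ → F} {α α' : ℕ → K} (h : IsCentralAt O N y z α)
    (hα : ∀ i ≤ N, α' i = α i) : IsCentralAt O N y z α' :=
  ⟨h.algebraMap_mem, h.zero, fun i hi hiN => by rw [hα i hiN]; exact h.ratio i hi hiN⟩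

theorem proposition2p6 (q : ℕ) {k K L : Type*} [Field k] [Finite k] [Field K] [Field L]
    [Algebra k K] [Algebra k L] [Algebra K L] [IsScalarTower k K L]
    (hk : Nat.card k = q) (hK : Nat.card K = q ^ 2) (hchar : Odd (ringChar k))
    (x : ℕ → L) (hx : IsKummerTower q K x)
    (t m : ℕ) (ht : 1 ≤ t) (htm : t ≤ m) (hq : (q : ℤ) ≡ -1 [ZMOD 2 ^ t]) :
    (centralPlaces k K x m t).ncard = 2 ^ (t - 1) * (q - 1) ∧
    ∃ Φ : centralPlaces k K x m t ≃ residueTuples q K t,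
      ∀ Q : centralPlaces k K x m t,
        Q.1.Congr (windowGen K x (m - t) (m + t) m (by omega)) (-1 / 2) ∧
        ∀ (i : ℕ) (_ : 1 ≤ i) (_ : i ≤ t),
          Q.1.Congr
            (windowGen K x (m - t) (m + t) (m + i) (by omega) /
              (windowGen K x (m - t) (m + t) (m - i) (by omega) + 1))
            (tupleEntry (Φ Q).1 i) := by
  subst hk
  have h1q : 1 < Nat.card k := Finite.one_lt_card
  have hchar2 : ringChar k ≠ 2 := fun h => by
    rw [h] at hchar
    exact absurd hchar (by decide)
  have h2 : (2 : k) ≠ 0 := Ring.two_ne_zero hchar2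
  have h2K : (2 : K) ≠ 0 := by
    have := (map_ne_zero (algebraMap k K)).2 h2
    rwa [map_ofNat] at this
  have hodd : Odd (Nat.card k) := by
    cases nonempty_fintype k
    rw [Nat.card_eq_fintype_card, Nat.odd_iff]
    exact FiniteField.odd_card_of_char_ne_two hchar2
  have hdvd : 2 ^ t ∣ Nat.card k + 1 := by
    have h := hq.symm.dvd
    rw [sub_neg_eq_add] at h
    exact_mod_cast h
  have hiff := fun α : Fin t → K =>
    isResidueChain_tupleEntry_iff h1q hK hodd ht hdvd (α := α)
  have hpair := hx.isBranchPair_window hodd htm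
  have hex : ∀ Q : centralPlaces k K x m t, ∃ α : residueTuples (Nat.card k) K t,
      IsCentralAt Q.1.ring t (windowRight K x m t) (windowLeft K x m t) (tupleEntry α.1) := by
    intro Q
    obtain ⟨α, hα, hQ⟩ := exists_isCentralAt_of_mem_centralPlaces hx hodd h2 hK ht htm Q.2
    have hα' := fun i (hi : i ≤ t) => tupleEntry_ofSequence hα.zero hi
    refine ⟨⟨fun j => α (j + 1), (hiff _).1 ⟨rfl, fun i hi => ?_⟩⟩, hQ.congr_chain hα'⟩
    rw [hα' _ hi, hα' _ hi.le]
    exact hα.succ i hi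
  choose Φ hΦ using hex
  have hinj : Function.Injective Φ := by
    intro Q Q' h
    have hQ' := hΦ Q'
    rw [← h] at hQ'
    have hα := (hiff _).2 (Φ Q).2
    exact Subtype.ext (Place.ext_ring (le_antisymm
      (hpair.le_of_isCentralAt hodd h2 ht hα (hΦ Q) hQ' (exists_windowField_fraction htm))
      (hpair.le_of_isCentralAt hodd h2 ht hα hQ' (hΦ Q) (exists_windowField_fraction htm))))
  have hsurj : Function.Surjective Φ := by
    intro α
    have hα := (hiff _).2 α.2
    obtain ⟨Q, hQ⟩ := exists_place_isCentralAt hx hodd h2 ht htm hα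
    refine ⟨⟨Q, mem_centralPlaces_of_isCentralAt hx hodd h2 ht htm hα hQ⟩, Subtype.ext ?_⟩
    funext j
    have h1 := (hΦ ⟨Q, mem_centralPlaces_of_isCentralAt hx hodd h2 ht htm hα hQ⟩).ratio (j + 1)
      (by omega) j.2
    have h3 := const_eq_of_congr hQ.algebraMap_mem h1 (hQ.ratio (j + 1) (by omega) j.2)
    simpa [tupleEntry] using h3
  let e := Equiv.ofBijective Φ ⟨hinj, hsurj⟩
  refine ⟨?_, e, fun Q => ⟨?_, fun i hi hit => ?_⟩⟩
  · rw [← Nat.card_coe_set_eq, Nat.card_congr e, Nat.card_coe_set_eq,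
      ncard_residueTuples rfl hK hodd h2K ht hdvd]
  · have := (hΦ Q).zero
    rw [← windowGen_add (i := 0) (by omega)] at this
    exact this
  · have := (hΦ Q).ratio i hi hit
    rw [← windowGen_add (by omega), ← windowGen_sub_add_one (by omega)] at this
    exact this
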